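/- Call a pair $(\Omega,T)$ of subsets of a finite abelian group $A$ a tiling pair if every $a\in A$ can be written uniquely as $a=\omega+t$ with $\omega\in\Omega$, $t\in T$; call a nonempty set $B\subseteq A$ periodic if $B+g=B$ for some $g\in A\setminus\{0\}$; and say that $A$ has the periodic tiling (PT) property if for every tiling pair $(\Omega,T)$ of $A$ either $\Omega$ is periodic or there is a periodic set $T'\subseteq A$ such that $(\Omega,T')$ is a tiling pair. Let $p$ be a prime, $n\ge 1$ an integer, and let $G$ be a subgroup of one of the groups $$\mathbb{Z}_2^5,\quad \mathbb{Z}_p^3,\quad \mathbb{Z}_{p^n}\times\mathbb{Z}_p,\quad \mathbb{Z}_{2^3}\times\mathbb{Z}_2^2,\quad \mathbb{Z}_{2^2}\times\mathbb{Z}_2^3 .$$ Let $m$ be a square-free positive integer with $\gcd(|G|,m)=1$, and assume that $G\times\mathbb{Z}_m$ is not the trivial group. Then $G\times\mathbb{Z}_m$ has the PT property. -/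

import Mathlib

/-- `(Ω, T)` is a tiling pair of the abelian group `G`: every element of `G` is uniquely
`ω + t` with `ω ∈ Ω` and `t ∈ T`. -/
def IsTilingPair {G : Type*} [AddCommGroup G] (Ω T : Set G) : Prop :=
  AddSubgroup.IsComplement Ω T

/-- A nonempty subset `A` of `G` is periodic if `A + g = A` for some nonzero `g`. -/
def IsPeriodicSet {G : Type*} [AddCommGroup G] (A : Set G) : Prop :=
  A.Nonempty ∧ ∃ g : G, g ≠ 0 ∧ (fun a => a + g) '' A = A

/-- The periodic tiling property: for each tiling pair `(Ω, T)`, either `Ω` is periodic or `T` can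
be replaced by a periodic set. -/
def HasPTProperty (G : Type*) [AddCommGroup G] : Prop :=
  ∀ Ω T : Set G, IsTilingPair Ω T →
    IsPeriodicSet Ω ∨ ∃ T' : Set G, IsPeriodicSet T' ∧ IsTilingPair Ω T'

/-- `G` is (isomorphic to) a subgroup of `H`. -/
def IsIsoToSubgroupOf (G H : Type*) [AddCommGroup G] [AddCommGroup H] : Prop :=
  ∃ K : AddSubgroup H, Nonempty (G ≃+ K)

/-!
# The periodic tiling property

Two reductions lead from `G × ZMod m` to `G`. Both rest on Tijdeman's theorem (`Tiles.image_nsmul`):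
a factor of a tiling may be multiplied by any number coprime to its size. If a prime `q ∣ m` divides
`#T`, then `q` does not divide `#Ω`, since it divides the order of the group just once; so `q • Ω`
and `T` tile, and hence so do `Ω` and the preimage of `T` under multiplication by `q`, which is
periodic. Otherwise `#T` is coprime to `m`, and `T` can be multiplied into `G`. Then `T` is a common
complement of all slices of `Ω`, and one has to show that a family `Ω i` of subsets of the `p`-group
`G` with a common complement has a common period or a common periodic complement (`CommonPT`,
`hasPTProperty_prod`).

In each of the groups in question there is an element `g` of order `p` which is a multiple of
`p • x` for every `x` with `p • x ≠ 0` (`IsSocleGenerator`), and subgroups inherit such an element.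
For every nontrivial character, the sum over `T` or the sums over all `Ω i` vanish. If the former
holds for all characters which are nontrivial on `g`, then `g` is a period of `T`; if it holds for
none of them, then `g` is a common period of the `Ω i`. In the remaining case, let `χ` be a
character nontrivial on `g` with vanishing sum over a set `F`. Its kernel `H` lies in the
`p`-torsion subgroup `K` and complements `g` there. The relations between roots of unity of
`p`-power order show that in each coset of `K` the set `F` is equidistributed among the cosets of
`H` (`commonPT_or_equidistributed`). This holds, with suitable `H`, for `F = T` as well as for all
`F = Ω i`, where `H` does not depend on `i`. If a set `E` satisfies `Ω i + E + K = G` for all `i`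
and has the right size, then `E + H` is a common complement (`commonPT_of_equidistributed`). This
settles the cases `#(Ω i) = p` and `#K ≤ p ^ 2`, and for `#T = p` the subgroup generated by a
difference of two points of `T` is a complement.

What is left are groups of order at most `32`, where `#T = 4`, or `#(Ω i) = 4` and `#T = 8`. An
equidistributed set of four points is a translate of `{0, a} + {0, b}` with `a` of order two, unless
all characters with vanishing sum over it are trivial on some `k ≠ 0` (`four_points`); in the latter
case `k` is a period of the complements. So let `Ω i = {0, a i} + {0, b i}`. Translation by `b i`
exchanges `T + {0, a i}` with its complement (`QuadTiling.sat_add_right`). Unless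
`commonPT_of_equidistributed` applies, one uses this to find a common period, or a period of `T`, or
a subgroup `P` of index four in `K` and a system `E` of representatives modulo `K` such that `E + P`
is a common complement. The latter is clear for the quadruples with `2 • b i = 0`, if the nonzero
elements of `P` are differences of elements of `T` (`tiles_thicken_of_torsion`); for the other ones
it is a condition on the differences of the elements of `E` (`tiles_thicken_of_notMem`). The choice
of `P` and `E` depends on whether `K` has order `8`, `16` or `32`, whether `g` is a difference of
elements of `T`, and whether `a i = g` (`QuadFamily.commonPT`). -/

namespace PeriodicTiling

open Finset Polynomial
open scoped Classical

set_option linter.unusedSectionVars false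

/-! ### Vanishing sums of roots of unity of prime power order -/

/-- If `Φ_{p^(n+1)}` divides a polynomial of degree less than `p^(n+1)`, then the coefficients of
the latter are periodic of period `p^n`. -/
lemma coeff_eq_of_cyclotomic_dvd {p n : ℕ} (hp : p.Prime) {P : ℤ[X]}
    (hP : P.natDegree < p ^ (n + 1)) (hdvd : cyclotomic (p ^ (n + 1)) ℤ ∣ P) {a b : ℕ}
    (ha : a < p ^ (n + 1)) (hb : b < p ^ (n + 1)) (hab : a % p ^ n = b % p ^ n) :
    P.coeff a = P.coeff b := by
  obtain ⟨Q, rfl⟩ := hdvd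
  have hM : 0 < p ^ n := pow_pos hp.pos n
  rcases eq_or_ne Q 0 with rfl | hQ
  · simp
  have hdeg : Q.natDegree < p ^ n := by
    rw [natDegree_mul (cyclotomic_ne_zero _ _) hQ, natDegree_cyclotomic,
      Nat.totient_prime_pow_succ hp] at hP
    have h1 : p ^ (n + 1) = p ^ n * (p - 1) + p ^ n := by
      obtain ⟨k, rfl⟩ : ∃ k, p = k + 1 := ⟨p - 1, by have := hp.pos; omega⟩
      simp [pow_succ]; ring
    omega
  -- the coefficient of index `c` only sees the summand `X ^ (p ^ n * (c / p ^ n))` of `Φ`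
  have key : ∀ c, c < p ^ (n + 1) →
      (cyclotomic (p ^ (n + 1)) ℤ * Q).coeff c = Q.coeff (c % p ^ n) := by
    intro c hc
    have := Fact.mk hp
    rw [cyclotomic_prime_pow_eq_geom_sum hp, Finset.sum_mul, finsetSum_coeff]
    rw [Finset.sum_eq_single (c / p ^ n)]
    · rw [← pow_mul, coeff_X_pow_mul', if_pos (Nat.mul_div_le c _)]
      congr 1
      exact Nat.sub_eq_of_eq_add (by rw [add_comm]; exact (Nat.div_add_mod c (p ^ n)).symm)
    · intro i _ hi
      rw [← pow_mul, coeff_X_pow_mul']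
      split_ifs with h
      · apply coeff_eq_zero_of_natDegree_lt
        refine hdeg.trans_le ?_
        by_contra hlt
        push Not at hlt
        apply hi
        have h2 : c / p ^ n = i := by
          apply Nat.div_eq_of_lt_le
          · rw [mul_comm]; exact h
          · rw [Nat.succ_mul, mul_comm]; omega
        exact h2.symm
      · rfl
    · intro h
      exfalso; apply h
      rw [Finset.mem_range, Nat.div_lt_iff_lt_mul hM]
      rw [pow_succ, mul_comm] at hc
      exact hc
  rw [key a ha, key b hb, hab]

section CommonComplement
variable {G : Type*} [AddCommGroup G] [Fintype G] {ι : Type*}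

/-- If the sum of a character over a subset `F` of a `p`-group vanishes, the fibres of the character
on `F` over values differing by a `p`-th root of unity have the same size. -/
lemma card_filter_char_eq {p N : ℕ} (hp : p.Prime) (hG : Fintype.card G = p ^ (N + 1))
    (χ : AddChar G ℂ) {F : Finset G} (hF : ∑ f ∈ F, χ f = 0) {g : G} (hg : p • g = 0) (x : G) :
    #{f ∈ F | χ f = χ x} = #{f ∈ F | χ f = χ (x + g)} := by
  have hpos : p ^ (N + 1) ≠ 0 := pow_ne_zero _ hp.ne_zero
  set ξ : ℂ := Complex.exp (2 * Real.pi * Complex.I / ((p ^ (N + 1) : ℕ) : ℂ)) with hξdef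
  have hξ : IsPrimitiveRoot ξ (p ^ (N + 1)) := Complex.isPrimitiveRoot_exp _ hpos
  have hroot : ∀ y : G, ∃ i < p ^ (N + 1), ξ ^ i = χ y := by
    intro y
    have := NeZero.mk hpos
    apply hξ.eq_pow_of_pow_eq_one
    rw [← AddChar.map_nsmul_eq_pow, ← hG, card_nsmul_eq_zero, AddChar.map_zero_eq_one]
  choose e he hξe using hroot
  set P : ℤ[X] := ∑ f ∈ F, X ^ e f with hPdef
  have hcoeff : ∀ j, P.coeff j = (#{f ∈ F | e f = j} : ℤ) := by
    intro j
    simp only [hPdef, finsetSum_coeff, coeff_X_pow, Finset.card_filter]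
    push_cast
    exact Finset.sum_congr rfl fun f _ => by simp [eq_comm]
  have hdeg : P.natDegree < p ^ (N + 1) := by
    apply lt_of_le_of_lt (b := p ^ (N + 1) - 1)
    · apply natDegree_sum_le_of_forall_le
      intro f _
      rw [natDegree_X_pow]
      have := he f
      omega
    · omega
  have hdvd : cyclotomic (p ^ (N + 1)) ℤ ∣ P := by
    rw [cyclotomic_eq_minpoly hξ (Nat.pos_of_ne_zero hpos)]
    apply minpoly.isIntegrallyClosed_dvd (hξ.isIntegral (Nat.pos_of_ne_zero hpos))
    simp only [hPdef, map_sum, map_pow, aeval_X]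
    rw [← hF]
    exact Finset.sum_congr rfl fun f _ => hξe f
  have hinj : ∀ y z, e y = e z ↔ χ y = χ z := by
    intro y z
    rw [← hξe y, ← hξe z]
    exact ⟨fun h => by rw [h], fun h => hξ.pow_inj (he y) (he z) h⟩
  have hmod : e x % p ^ N = e (x + g) % p ^ N := by
    -- `χ g` is a `p`-th root of unity, hence a power of `ξ ^ (p ^ N)`
    have h1 : p ^ N ∣ e g := by
      have h2 : ξ ^ (e g * p) = 1 := by
        rw [pow_mul, hξe, ← AddChar.map_nsmul_eq_pow, hg, AddChar.map_zero_eq_one]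
      have h3 := hξ.dvd_of_pow_eq_one _ h2
      rw [pow_succ] at h3
      exact Nat.dvd_of_mul_dvd_mul_right hp.pos h3
    have h4 : ξ ^ e (x + g) = ξ ^ (e x + e g) := by
      rw [hξe, pow_add, hξe, hξe, AddChar.map_add_eq_mul]
    have h5 : e (x + g) ≡ e x + e g [MOD p ^ (N + 1)] := by
      have h8 : ξ ^ ((e x + e g) % p ^ (N + 1)) = ξ ^ (e x + e g) :=
        pow_eq_pow_of_modEq (Nat.mod_modEq _ _) hξ.pow_eq_one
      have h9 := hξ.pow_inj (he (x + g)) (Nat.mod_lt _ (Nat.pos_of_ne_zero hpos)) (h4.trans h8.symm)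
      rw [h9]
      exact Nat.mod_modEq _ _
    have h6 := h5.of_dvd (pow_dvd_pow p (Nat.le_succ N))
    unfold Nat.ModEq at h6
    rw [h6, Nat.add_mod, Nat.mod_eq_zero_of_dvd h1, add_zero, Nat.mod_mod]
  have := coeff_eq_of_cyclotomic_dvd hp hdeg hdvd (he x) (he (x + g)) hmod
  rw [hcoeff, hcoeff] at this
  have h7 : #{f ∈ F | e f = e x} = #{f ∈ F | e f = e (x + g)} := by exact_mod_cast this
  simpa only [hinj] using h7

/-! ### Tilings by finite sets -/

/-- The finite sets `Ω` and `T` tile `G`. -/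
def Tiles (Ω T : Finset G) : Prop := IsTilingPair (Ω : Set G) (T : Set G)

/-- The finite set `F` is invariant under translation by some nonzero element. -/
def HasPeriod (F : Finset G) : Prop := ∃ g : G, g ≠ 0 ∧ ∀ f ∈ F, f + g ∈ F

namespace Tiles
variable {Ω T : Finset G}

lemma exists_add_eq (h : Tiles Ω T) (x : G) : ∃ w ∈ Ω, ∃ t ∈ T, w + t = x := by
  obtain ⟨⟨⟨w, hw⟩, ⟨t, ht⟩⟩, hx⟩ := h.2 x
  exact ⟨w, hw, t, ht, hx⟩

lemma eq_and_eq (h : Tiles Ω T) {w w' t t' : G} (hw : w ∈ Ω) (hw' : w' ∈ Ω) (ht : t ∈ T)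
    (ht' : t' ∈ T) (he : w + t = w' + t') : w = w' ∧ t = t' := by
  have := h.1 (a₁ := (⟨w, hw⟩, ⟨t, ht⟩)) (a₂ := (⟨w', hw'⟩, ⟨t', ht'⟩)) he
  simpa using this

lemma card_mul (h : Tiles Ω T) : #Ω * #T = Fintype.card G := by
  have := AddSubgroup.IsComplement.card_mul_card h
  simpa using this

lemma symm (h : Tiles Ω T) : Tiles T Ω := by
  constructor
  · rintro ⟨⟨t, ht⟩, ⟨w, hw⟩⟩ ⟨⟨t', ht'⟩, ⟨w', hw'⟩⟩ he
    have := h.eq_and_eq hw hw' ht ht' (by simpa [add_comm] using he)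
    simp [this]
  · intro x
    obtain ⟨w, hw, t, ht, hx⟩ := h.exists_add_eq x
    exact ⟨(⟨t, ht⟩, ⟨w, hw⟩), by simpa [add_comm] using hx⟩

lemma of_exists (hs : ∀ x, ∃ w ∈ Ω, ∃ t ∈ T, w + t = x) (hc : #Ω * #T ≤ Fintype.card G) :
    Tiles Ω T := by
  have hsurj : Function.Surjective fun x : ↥(Ω : Set G) × ↥(T : Set G) => x.1.1 + x.2.1 := by
    intro x
    obtain ⟨w, hw, t, ht, hx⟩ := hs x
    exact ⟨(⟨w, hw⟩, ⟨t, ht⟩), hx⟩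
  refine ⟨?_, hsurj⟩
  refine (Function.Surjective.bijective_of_nat_card_le hsurj ?_).1
  simpa using hc

lemma of_inj (hi : ∀ w ∈ Ω, ∀ w' ∈ Ω, ∀ t ∈ T, ∀ t' ∈ T, w + t = w' + t' → w = w' ∧ t = t')
    (hc : Fintype.card G ≤ #Ω * #T) : Tiles Ω T := by
  have hinj : Function.Injective fun x : ↥(Ω : Set G) × ↥(T : Set G) => x.1.1 + x.2.1 := by
    rintro ⟨⟨t, ht⟩, ⟨w, hw⟩⟩ ⟨⟨t', ht'⟩, ⟨w', hw'⟩⟩ he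
    have := hi t ht t' ht' w hw w' hw' he
    simp [this]
  refine Function.Injective.bijective_of_nat_card_le hinj ?_
  simpa using hc

lemma nonempty_left (h : Tiles Ω T) : Ω.Nonempty := by
  obtain ⟨w, hw, -⟩ := h.exists_add_eq 0
  exact ⟨w, hw⟩

lemma nonempty_right (h : Tiles Ω T) : T.Nonempty := h.symm.nonempty_left

end Tiles

/-! ### Dilating a factor of a tiling -/

/-- Tijdeman's theorem for a prime dilation. -/
lemma Tiles.image_prime_nsmul {Ω T : Finset G} (h : Tiles Ω T) {q : ℕ} (hq : q.Prime)
    (hqT : ¬ q ∣ #T) : Tiles Ω (T.image (q • ·)) := by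
  have := Fact.mk hq
  -- Work in the group algebra over `ZMod q`, where `Σ q • t` is the `q`-th power of `Σ t`.
  let δ : G → AddMonoidAlgebra (ZMod q) G := fun x => AddMonoidAlgebra.single x 1
  have hδ : ∀ x y, δ x * δ y = δ (x + y) := fun x y => by
    simp [δ, AddMonoidAlgebra.single_mul_single]
  set s : Finset G → AddMonoidAlgebra (ZMod q) G := fun F => ∑ f ∈ F, δ f with hs
  have hmul : s Ω * s T = s univ := by
    simp only [hs, Finset.sum_mul_sum, hδ]
    rw [← Finset.sum_product']
    refine Finset.sum_nbij (fun x => x.1 + x.2) (by simp) ?_ ?_ (by simp)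
    · rintro ⟨a, b⟩ hab ⟨c, d⟩ hcd he
      simp only [Finset.coe_product, Set.mem_prod, Finset.mem_coe] at hab hcd
      have := h.eq_and_eq hab.1 hcd.1 hab.2 hcd.2 he
      ext <;> simp [this]
    · intro x _
      obtain ⟨w, hw, t, ht, hx⟩ := h.exists_add_eq x
      exact ⟨(w, t), by simp [hw, ht], hx⟩
  have huniv : ∀ t, s univ * δ t = s univ := by
    intro t
    simp only [hs, Finset.sum_mul, hδ]
    exact Fintype.sum_equiv (Equiv.addRight t) _ _ (fun x => rfl)
  have hunivT : s univ * s T = (#T : ZMod q) • s univ := by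
    rw [show s T = ∑ t ∈ T, δ t from rfl, Finset.mul_sum, Finset.sum_congr rfl fun t _ => huniv t,
      Finset.sum_const, Nat.cast_smul_eq_nsmul]
  have hpow : ∀ k, s univ * s T ^ k = (#T : ZMod q) ^ k • s univ := by
    intro k
    induction k with
    | zero => simp
    | succ k ih => rw [pow_succ, ← mul_assoc, ih, smul_mul_assoc, hunivT, smul_smul, pow_succ]
  have hTne : (#T : ZMod q) ≠ 0 := by rwa [Ne, ZMod.natCast_eq_zero_iff]
  have hfrob : s Ω * ∑ t ∈ T, δ (q • t) = s univ := by
    have h1 : ∑ t ∈ T, δ (q • t) = s T ^ q := by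
      simp only [hs]
      have : CharP (AddMonoidAlgebra (ZMod q) G) q :=
        (Algebra.charP_iff (ZMod q) (AddMonoidAlgebra (ZMod q) G) q).1 inferInstance
      rw [sum_pow_char]
      exact Finset.sum_congr rfl fun t _ => by simp [δ, AddMonoidAlgebra.single_pow]
    rw [h1]
    obtain ⟨k, rfl⟩ : ∃ k, q = k + 1 := ⟨q - 1, by have := hq.pos; omega⟩
    rw [pow_succ', ← mul_assoc, hmul, hpow]
    have : (#T : ZMod (k + 1)) ^ k = 1 := by
      simpa using ZMod.pow_card_sub_one_eq_one hTne
    rw [this, one_smul]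
  apply Tiles.of_exists
  · intro x
    by_contra hx
    push Not at hx
    have h1 := congrArg (fun u : AddMonoidAlgebra (ZMod q) G => u.coeff x) hfrob
    simp only [hs, Finset.sum_mul_sum, hδ, AddMonoidAlgebra.coeff_sum,
      Finsupp.finsetSum_apply] at h1
    rw [Finset.sum_eq_zero] at h1
    · simp [δ, AddMonoidAlgebra.coeff_single, Finsupp.single_apply] at h1
    · intro w hw
      refine Finset.sum_eq_zero fun t ht => ?_
      simp [δ, AddMonoidAlgebra.coeff_single,
        hx w hw (q • t) (Finset.mem_image_of_mem _ ht)]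
  · calc #Ω * #(T.image (q • ·)) ≤ #Ω * #T := Nat.mul_le_mul_left _ Finset.card_image_le
      _ = Fintype.card G := h.card_mul
      _ ≤ _ := le_rfl

/-- Tijdeman's theorem: a factor of a tiling can be multiplied by any number coprime to its size. -/
lemma Tiles.image_nsmul {Ω T : Finset G} (h : Tiles Ω T) {k : ℕ} (hk : k ≠ 0)
    (hkT : k.Coprime #T) : Tiles Ω (T.image (k • ·)) := by
  induction k using Nat.recOnMul generalizing T with
  | zero => exact absurd rfl hk
  | one => simpa using h
  | prime q hq => exact h.image_prime_nsmul hq ((Nat.Prime.coprime_iff_not_dvd hq).1 hkT)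
  | mul a b iha ihb =>
    have hb := ihb h (by rintro rfl; simp at hk) (Nat.Coprime.coprime_mul_left hkT)
    have hcard : #(T.image (b • ·)) = #T := by
      have h1 := hb.card_mul
      rw [← h.card_mul] at h1
      exact Nat.eq_of_mul_eq_mul_left (Finset.card_pos.2 h.nonempty_left) h1
    have := iha hb (by rintro rfl; simp at hk)
      (by rw [hcard]; exact Nat.Coprime.coprime_mul_right hkT)
    rw [Finset.image_image] at this
    convert this using 2
    ext x
    simp [mul_smul]

/-- A multiple of a difference of two elements of `T`, by a factor coprime to `#T`, is not a nonzero
difference of elements of `Ω`. -/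
lemma Tiles.eq_of_add_nsmul_eq {Ω T : Finset G} (h : Tiles Ω T) {k : ℕ} (hk : k ≠ 0)
    (hkT : k.Coprime #T) {w w' t t' : G} (hw : w ∈ Ω) (hw' : w' ∈ Ω) (ht : t ∈ T) (ht' : t' ∈ T)
    (he : w + k • t = w' + k • t') : w = w' :=
  ((h.image_nsmul hk hkT).eq_and_eq hw hw' (Finset.mem_image_of_mem _ ht)
    (Finset.mem_image_of_mem _ ht') he).1

/-! ### Character sums and periods -/

lemma Tiles.char_sum_mul {Ω T : Finset G} (h : Tiles Ω T) {χ : AddChar G ℂ} (hχ : χ ≠ 0) :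
    (∑ w ∈ Ω, χ w) * ∑ t ∈ T, χ t = 0 := by
  rw [← AddChar.sum_eq_zero_iff_ne_zero.2 hχ, Finset.sum_mul_sum, ← Finset.sum_product']
  refine Finset.sum_nbij (fun x => x.1 + x.2) (by simp) ?_ ?_ ?_
  · rintro ⟨a, b⟩ hab ⟨c, d⟩ hcd he
    simp only [Finset.coe_product, Set.mem_prod, Finset.mem_coe] at hab hcd
    have := h.eq_and_eq hab.1 hcd.1 hab.2 hcd.2 he
    ext <;> simp [this]
  · intro x _
    obtain ⟨w, hw, t, ht, hx⟩ := h.exists_add_eq x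
    exact ⟨(w, t), by simp [hw, ht], hx⟩
  · intro x _
    simp [AddChar.map_add_eq_mul]

/-- A set all of whose Fourier coefficients at the characters nontrivial on `g` vanish is invariant
under translation by `g`. -/
lemma add_mem_of_char_sum {F : Finset G} {g : G}
    (h : ∀ χ : AddChar G ℂ, χ g ≠ 1 → ∑ f ∈ F, χ f = 0) {x : G} (hx : x ∈ F) : x + g ∈ F := by
  have key : ∀ y : G, ∑ χ : AddChar G ℂ, χ (-y) * ∑ f ∈ F, χ f
      = if y ∈ F then (Fintype.card G : ℂ) else 0 := by
    intro y
    simp_rw [Finset.mul_sum, ← AddChar.map_add_eq_mul]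
    rw [Finset.sum_comm]
    simp_rw [AddChar.sum_apply_eq_ite, neg_add_eq_zero]
    simp
  have h1 := key (x + g)
  have h2 := key x
  have h3 : ∑ χ : AddChar G ℂ, χ (-(x + g)) * ∑ f ∈ F, χ f
      = ∑ χ : AddChar G ℂ, χ (-x) * ∑ f ∈ F, χ f := by
    refine Finset.sum_congr rfl fun χ _ => ?_
    by_cases hg : χ g = 1
    · rw [neg_add, AddChar.map_add_eq_mul, AddChar.map_neg_eq_inv χ g, hg]; simp
    · rw [h χ hg]; simp
  rw [h1, h2, if_pos hx] at h3
  by_contra hn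
  rw [if_neg hn] at h3
  have : (Fintype.card G : ℂ) ≠ 0 := by exact_mod_cast Fintype.card_ne_zero
  exact this h3.symm

/-! ### Families with a common complement -/

/-- The sets `Ω i` have a common nonzero period, or they have a common periodic tiling
complement. -/
def CommonPT (Ω : ι → Finset G) : Prop :=
  (∃ g : G, g ≠ 0 ∧ ∀ i, ∀ w ∈ Ω i, w + g ∈ Ω i) ∨
    ∃ T : Finset G, HasPeriod T ∧ ∀ i, Tiles (Ω i) T

/-- The element `g` has order `p` and lies in every subgroup generated by some `p • x ≠ 0`. In a
`p`-group with `p • G` cyclic and nonzero, this means that `g` generates the subgroup of order `p`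
of `p • G`; if `p • G = 0`, then `g` is any nonzero element. -/
structure IsSocleGenerator (p : ℕ) (g : G) : Prop where
  ne_zero : g ≠ 0
  nsmul_eq_zero : p • g = 0
  eq_nsmul : ∀ x : G, p • x ≠ 0 → ∃ j : ℕ, g = j • p • x

/-- Let `K` be the `p`-torsion subgroup of `G`. Then `H` is a complement in `K` of the subgroup
generated by `g`, and in each coset of `K` the set `F` is equidistributed among the cosets
of `H`. -/
structure Equidistributed (p : ℕ) (g : G) (H : AddSubgroup G) (F : Finset G) : Prop where
  nsmul_eq_zero : ∀ h ∈ H, p • h = 0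
  notMem : g ∉ H
  exists_sub_mem : ∀ k : G, p • k = 0 → ∃ j : ℕ, k - j • g ∈ H
  card_eq : ∀ x, #{f ∈ F | f - x ∈ H} = #{f ∈ F | f - (x + g) ∈ H}

namespace Equidistributed
variable {p : ℕ} {g : G} {H : AddSubgroup G} {F : Finset G}

lemma card_eq_nsmul (h : Equidistributed p g H F) (x : G) (j : ℕ) :
    #{f ∈ F | f - x ∈ H} = #{f ∈ F | f - (x + j • g) ∈ H} := by
  induction j with
  | zero => simp
  | succ j ih => rw [ih, h.card_eq, succ_nsmul, add_assoc]

/-- A coset of the `p`-torsion subgroup consists of the `p` cosets `x + j • g + H`. -/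
lemma card_coset (h : Equidistributed p g H F) (hp : p.Prime) (hg : p • g = 0) (x : G) :
    p * #{f ∈ F | f - x ∈ H} = #{f ∈ F | p • (f - x) = 0} := by
  have hunion : {f ∈ F | p • (f - x) = 0}
      = (Finset.range p).biUnion fun j => {f ∈ F | f - (x + j • g) ∈ H} := by
    ext f
    simp only [Finset.mem_filter, Finset.mem_biUnion, Finset.mem_range]
    constructor
    · rintro ⟨hf, hfx⟩
      obtain ⟨j, hj⟩ := h.exists_sub_mem _ hfx
      refine ⟨j % p, Nat.mod_lt _ hp.pos, hf, ?_⟩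
      have : (j % p) • g = j • g := by
        conv_rhs => rw [← Nat.div_add_mod j p, add_nsmul, mul_comm, mul_nsmul', hg]
        simp
      rw [this, ← sub_sub]
      exact hj
    · rintro ⟨j, _, hf, hfx⟩
      refine ⟨hf, ?_⟩
      have h1 := h.nsmul_eq_zero _ hfx
      have h2 : f - x = (f - (x + j • g)) + j • g := by abel
      rw [h2, nsmul_add, h1, smul_comm, hg]
      simp
  have key : ∀ i j : ℕ, i < j → j < p → ∀ f, f - (x + i • g) ∈ H → f - (x + j • g) ∉ H := by
    intro i j hij hj f h1 h2
    have h3 : (j - i) • g ∈ H := by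
      have h4 := H.sub_mem h1 h2
      have h5 : j • g = (j - i) • g + i • g := by rw [← add_nsmul]; congr 1; omega
      rw [h5] at h4
      convert h4 using 1
      abel
    have hcop : (j - i).Coprime p :=
      (Nat.coprime_of_lt_prime (by omega) (by omega) hp).symm
    obtain ⟨u, -, hu⟩ := Nat.exists_mul_mod_eq_one_of_coprime hcop hp.one_lt
    apply h.notMem
    have h6 : ((j - i) * u) • g ∈ H := by
      rw [mul_nsmul]
      exact H.nsmul_mem h3 u
    rw [← Nat.div_add_mod ((j - i) * u) p, hu, add_nsmul, mul_comm p, mul_nsmul', hg] at h6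
    simpa using h6
  rw [hunion, Finset.card_biUnion]
  · rw [← Finset.sum_congr rfl fun j _ => h.card_eq_nsmul x j]
    simp
  · intro i hi j hj hij
    rw [Finset.mem_coe, Finset.mem_range] at hi hj
    rw [Function.onFun, Finset.disjoint_left]
    intro f hf hf'
    rw [Finset.mem_filter] at hf hf'
    rcases Nat.lt_or_gt_of_ne hij with h1 | h1
    · exact key i j h1 hj f hf.2 hf'.2
    · exact key j i h1 hi f hf'.2 hf.2

/-- A coset of the `p`-torsion subgroup meeting `F` contains at least `p` points of `F`. -/
lemma le_card_coset (h : Equidistributed p g H F) (hp : p.Prime) (hg : p • g = 0) {x : G}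
    (hx : x ∈ F) : p ≤ #{f ∈ F | p • (f - x) = 0} := by
  rw [← h.card_coset hp hg x]
  refine Nat.le_mul_of_pos_right _ (Finset.card_pos.2 ⟨x, ?_⟩)
  simp [hx, H.zero_mem]

/-- If `F` meets a coset of the `p`-torsion subgroup, it meets all cosets of `H` in it. -/
lemma exists_sub_mem_of_mem (h : Equidistributed p g H F) {x y : G}
    (hx : x ∈ F) (hy : p • (y - x) = 0) : ∃ f ∈ F, p • (f - x) = 0 ∧ f - y ∈ H := by
  obtain ⟨j, hj⟩ := h.exists_sub_mem _ hy
  have h1 : 0 < #{f ∈ F | f - (x + j • g) ∈ H} := by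
    rw [← h.card_eq_nsmul]
    exact Finset.card_pos.2 ⟨x, by simp [hx, H.zero_mem]⟩
  obtain ⟨f, hf⟩ := Finset.card_pos.1 h1
  rw [Finset.mem_filter] at hf
  have h2 : f - y ∈ H := by
    have := H.sub_mem hf.2 hj
    convert this using 1
    abel
  refine ⟨f, hf.1, ?_, h2⟩
  have : f - x = (f - y) + (y - x) := by abel
  rw [this, nsmul_add, hy, h.nsmul_eq_zero _ h2, add_zero]

lemma univ (h : Equidistributed p g H F) : Equidistributed p g H Finset.univ where
  nsmul_eq_zero := h.nsmul_eq_zero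
  notMem := h.notMem
  exists_sub_mem := h.exists_sub_mem
  card_eq x := by
    refine Finset.card_bij (fun f _ => f + g) ?_ ?_ ?_
    · intro f hf
      simpa using hf
    · intro a _ b _ hab
      simpa using hab
    · intro b hb
      refine ⟨b - g, ?_, by simp⟩
      simp only [Finset.mem_filter, Finset.mem_univ, true_and] at hb ⊢
      convert hb using 1
      abel

lemma card_subgroup (h : Equidistributed p g H F) (hp : p.Prime) (hg : p • g = 0) :
    p * #{x : G | x ∈ H} = #{x : G | p • x = 0} := by
  simpa using h.univ.card_coset hp hg 0

/-- If `H` is trivial, then `F` is invariant under translation by `g`. -/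
lemma add_mem (h : Equidistributed p g H F) (hH : ∀ x ∈ H, x = 0) {x : G} (hx : x ∈ F) :
    x + g ∈ F := by
  have h1 : 0 < #{f ∈ F | f - (x + g) ∈ H} := by
    rw [← h.card_eq]
    exact Finset.card_pos.2 ⟨x, by simp [hx, H.zero_mem]⟩
  obtain ⟨f, hf⟩ := Finset.card_pos.1 h1
  rw [Finset.mem_filter] at hf
  have := sub_eq_zero.1 (hH _ hf.2)
  rw [← this]
  exact hf.1

end Equidistributed

/-- The kernel of a character. -/
def charKer (χ : AddChar G ℂ) : AddSubgroup G where
  carrier := {x | χ x = 1}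
  add_mem' {a b} ha hb := by
    simp only [Set.mem_ofPred_eq] at *
    rw [AddChar.map_add_eq_mul, ha, hb, one_mul]
  zero_mem' := by simp
  neg_mem' {a} ha := by
    simp only [Set.mem_ofPred_eq] at *
    rw [AddChar.map_neg_eq_inv, ha, inv_one]

lemma mem_charKer {χ : AddChar G ℂ} {x : G} : x ∈ charKer χ ↔ χ x = 1 := Iff.rfl

lemma sub_mem_charKer {χ : AddChar G ℂ} {x y : G} : x - y ∈ charKer χ ↔ χ x = χ y := by
  rw [mem_charKer, AddChar.map_sub_eq_div, div_eq_one_iff_eq (χ.val_isUnit y).ne_zero]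

/-- The kernel of `χ` consists of `p`-torsion, since every other element has the socle generator `g`
as a multiple. -/
lemma equidistributed_of_char_sum {p N : ℕ} (hp : p.Prime) (hG : Fintype.card G = p ^ (N + 1))
    {g : G} (hg : IsSocleGenerator p g) {χ : AddChar G ℂ} (hχ : χ g ≠ 1) {F : Finset G}
    (hF : ∑ f ∈ F, χ f = 0) : Equidistributed p g (charKer χ) F where
  nsmul_eq_zero x hx := by
    by_contra hne
    obtain ⟨j, hj⟩ := hg.eq_nsmul x hne
    apply hχ
    rw [hj, AddChar.map_nsmul_eq_pow, AddChar.map_nsmul_eq_pow, mem_charKer.1 hx]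
    simp
  notMem := hχ
  exists_sub_mem k hk := by
    have h1 : χ g ^ p = 1 := by
      rw [← AddChar.map_nsmul_eq_pow, hg.nsmul_eq_zero, AddChar.map_zero_eq_one]
    have := Fact.mk hp
    have := NeZero.mk hp.ne_zero
    have h2 : IsPrimitiveRoot (χ g) p := by
      rw [← orderOf_eq_prime h1 hχ]
      exact IsPrimitiveRoot.orderOf _
    obtain ⟨j, _, hj⟩ := h2.eq_pow_of_pow_eq_one (ξ := χ k) (by
      rw [← AddChar.map_nsmul_eq_pow, hk, AddChar.map_zero_eq_one])
    refine ⟨j, ?_⟩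
    rw [sub_mem_charKer, AddChar.map_nsmul_eq_pow, hj]
  card_eq x := by
    simp only [sub_mem_charKer]
    exact card_filter_char_eq hp hG χ hF hg.nsmul_eq_zero x

/-- Either there is a common period, or `T` is periodic, or both the `Ω i` and `T` are
equidistributed. -/
lemma commonPT_or_equidistributed {p N : ℕ} (hp : p.Prime) (hG : Fintype.card G = p ^ (N + 1))
    {g : G} (hg : IsSocleGenerator p g) {Ω : ι → Finset G} {T : Finset G}
    (hT : ∀ i, Tiles (Ω i) T) :
    CommonPT Ω ∨ ((∃ H, ∀ i, Equidistributed p g H (Ω i)) ∧ ∃ H, Equidistributed p g H T) := by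
  have hne : ∀ χ : AddChar G ℂ, χ g ≠ 1 → χ ≠ 0 := by
    rintro χ h rfl
    simp at h
  by_cases h0 : ∃ χ : AddChar G ℂ, χ g ≠ 1 ∧ ∑ t ∈ T, χ t ≠ 0
  · by_cases h1 : ∃ χ : AddChar G ℂ, χ g ≠ 1 ∧ ∑ t ∈ T, χ t = 0
    · obtain ⟨χ₀, h0, h0'⟩ := h0
      obtain ⟨χ₁, h1, h1'⟩ := h1
      refine Or.inr ⟨⟨_, fun i => equidistributed_of_char_sum hp hG hg h0 ?_⟩,
        ⟨_, equidistributed_of_char_sum hp hG hg h1 h1'⟩⟩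
      exact (mul_eq_zero.1 ((hT i).char_sum_mul (hne _ h0))).resolve_right h0'
    · push Not at h1
      refine Or.inl (Or.inl ⟨g, hg.ne_zero, fun i w hw => add_mem_of_char_sum ?_ hw⟩)
      intro χ hχ
      exact (mul_eq_zero.1 ((hT i).char_sum_mul (hne _ hχ))).resolve_right (h1 χ hχ)
  · push Not at h0
    exact Or.inl (Or.inr ⟨T, ⟨g, hg.ne_zero, fun t ht => add_mem_of_char_sum h0 ht⟩, hT⟩)

/-! ### Factors of prime size and small torsion -/

/-- The union of the cosets `e + P`, `e ∈ E`. -/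
noncomputable def thicken (E : Finset G) (P : AddSubgroup G) : Finset G := {x | ∃ e ∈ E, x - e ∈ P}

lemma mem_thicken {E : Finset G} {P : AddSubgroup G} {x : G} :
    x ∈ thicken E P ↔ ∃ e ∈ E, x - e ∈ P := by simp [thicken]

lemma card_thicken_le (E : Finset G) (P : AddSubgroup G) :
    #(thicken E P) ≤ #E * #{x : G | x ∈ P} := by
  rw [← Finset.card_product]
  refine Finset.card_le_card_of_surjOn (fun x => x.1 + x.2) ?_
  intro x hx
  obtain ⟨e, he, h⟩ := mem_thicken.1 hx
  exact ⟨(e, x - e), by simp [he, h], by simp⟩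

lemma hasPeriod_thicken (E : Finset G) {P : AddSubgroup G} {h : G} (hh : h ∈ P) (h0 : h ≠ 0) :
    HasPeriod (thicken E P) := by
  refine ⟨h, h0, fun f hf => ?_⟩
  obtain ⟨e, he, hfe⟩ := mem_thicken.1 hf
  refine mem_thicken.2 ⟨e, he, ?_⟩
  have := P.add_mem hfe hh
  convert this using 1
  abel

/-- A transversal modulo the `p`-torsion subgroup, thickened by the subgroup in the definition of
equidistribution, complements equidistributed sets. -/
lemma commonPT_of_equidistributed {p : ℕ} {g : G}
    (hg : IsSocleGenerator p g) {Ω : ι → Finset G} {H : AddSubgroup G}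
    (hΩ : ∀ i, Equidistributed p g H (Ω i)) (E : Finset G)
    (hE : ∀ i y, ∃ w ∈ Ω i, ∃ e ∈ E, p • (y - w - e) = 0)
    (hcard : ∀ i, #(Ω i) * (#E * #{x : G | x ∈ H}) ≤ Fintype.card G) : CommonPT Ω := by
  by_cases hH : ∀ x ∈ H, x = 0
  · exact Or.inl ⟨g, hg.ne_zero, fun i w hw => (hΩ i).add_mem hH hw⟩
  push Not at hH
  obtain ⟨h, hh, h0⟩ := hH
  refine Or.inr ⟨thicken E H, hasPeriod_thicken E hh h0, fun i => Tiles.of_exists ?_ ?_⟩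
  · intro y
    obtain ⟨w, hw, e, he, hy⟩ := hE i y
    obtain ⟨f, hf, -, hfy⟩ := (hΩ i).exists_sub_mem_of_mem hw (y := y - e)
      (by rw [← hy]; congr 1; abel)
    refine ⟨f, hf, y - f, mem_thicken.2 ⟨e, he, ?_⟩, by simp⟩
    have := H.neg_mem hfy
    convert this using 1
    abel
  · exact (Nat.mul_le_mul_left _ (card_thicken_le E H)).trans (hcard i)

/-- There is a set of representatives of a finite set modulo the `p`-torsion subgroup. -/
lemma exists_representatives (p : ℕ) (F : Finset G) :
    ∃ E ⊆ F, (∀ f ∈ F, ∃ e ∈ E, p • (f - e) = 0) ∧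
      ∀ e ∈ E, ∀ e' ∈ E, p • (e - e') = 0 → e = e' := by
  -- The cosets of the `p`-torsion subgroup are the fibres of `x ↦ p • x`.
  have hr : ∀ y ∈ F.image (p • ·), ∃ f ∈ F, p • f = y := by
    intro y hy
    simpa using hy
  choose! r hrF hr using hr
  refine ⟨(F.image (p • ·)).image r, ?_, ?_, ?_⟩
  · intro x hx
    obtain ⟨y, hy, rfl⟩ := Finset.mem_image.1 hx
    exact hrF y hy
  · intro f hf
    have := Finset.mem_image_of_mem (p • ·) hf
    refine ⟨r (p • f), Finset.mem_image_of_mem _ this, ?_⟩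
    rw [nsmul_sub, hr _ this, sub_self]
  · intro e he e' he' hee
    obtain ⟨y, hy, rfl⟩ := Finset.mem_image.1 he
    obtain ⟨y', hy', rfl⟩ := Finset.mem_image.1 he'
    rw [nsmul_sub, hr y hy, hr y' hy', sub_eq_zero] at hee
    rw [hee]

/-- If each coset of the `p`-torsion subgroup meeting `F` contains at least `n` points of `F`, then
`F` meets at most `#F / n` cosets. -/
lemma card_representatives_mul_le {p n : ℕ} {E F : Finset G} (hEF : E ⊆ F)
    (hE : ∀ e ∈ E, ∀ e' ∈ E, p • (e - e') = 0 → e = e')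
    (hF : ∀ x ∈ F, n ≤ #{f ∈ F | p • (f - x) = 0}) : #E * n ≤ #F := by
  calc #E * n = ∑ e ∈ E, n := by simp
    _ ≤ ∑ e ∈ E, #{f ∈ F | p • (f - e) = 0} := Finset.sum_le_sum fun e he => hF e (hEF he)
    _ = #(E.biUnion fun e => {f ∈ F | p • (f - e) = 0}) := by
        rw [Finset.card_biUnion]
        intro e he e' he' hne
        rw [Function.onFun, Finset.disjoint_left]
        intro f hf hf'
        rw [Finset.mem_filter] at hf hf'
        apply hne
        apply hE e he e' he'
        have : e - e' = (f - e') - (f - e) := by abel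
        rw [this, nsmul_sub, hf.2, hf'.2, sub_self]
    _ ≤ #F := Finset.card_le_card (by
        intro f hf
        obtain ⟨e, _, he⟩ := Finset.mem_biUnion.1 hf
        exact (Finset.mem_filter.1 he).1)

lemma card_torsion_coset (p : ℕ) (x : G) :
    #{f : G | p • (f - x) = 0} = #{y : G | p • y = 0} := by
  refine Finset.card_bij (fun f _ => f - x) ?_ ?_ ?_
  · intro f hf; simpa using hf
  · intro a _ b _ h; simpa using h
  · intro b hb; exact ⟨b + x, by simpa using hb, by simp⟩

/-- An equidistributed set of `p` elements lies in one coset of the `p`-torsion subgroup, so any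
transversal modulo that subgroup can be thickened to a common complement. -/
lemma commonPT_of_card_eq_prime {p : ℕ} (hp : p.Prime) {g : G}
    (hg : IsSocleGenerator p g) {Ω : ι → Finset G} {H : AddSubgroup G}
    (hΩ : ∀ i, Equidistributed p g H (Ω i)) (hcard : ∀ i, #(Ω i) = p) : CommonPT Ω := by
  rcases isEmpty_or_nonempty ι with _ | ⟨⟨i₀⟩⟩
  · exact Or.inl ⟨g, hg.ne_zero, fun i => isEmptyElim i⟩
  obtain ⟨E, hEF, hE1, hE2⟩ := exists_representatives p (Finset.univ : Finset G)
  refine commonPT_of_equidistributed hg hΩ E ?_ ?_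
  · intro i y
    obtain ⟨w, hw⟩ := Finset.card_pos.1 ((hcard i).symm ▸ hp.pos : 0 < #(Ω i))
    obtain ⟨e, he, hy⟩ := hE1 (y - w) (Finset.mem_univ _)
    exact ⟨w, hw, e, he, hy⟩
  · intro i
    have h1 := card_representatives_mul_le hEF hE2 (n := #{y : G | p • y = 0})
      (fun x _ => (card_torsion_coset p x).ge)
    rw [← (hΩ i).card_subgroup hp hg.nsmul_eq_zero, Finset.card_univ] at h1
    rw [hcard]
    linarith

/-- If `T` has `p` elements, the difference of two of them has order `p`, and the subgroup generated
by it is a common complement by Tijdeman's theorem. -/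
lemma commonPT_of_tiles_card_eq_prime {p : ℕ} (hp : p.Prime) {g : G}
    (hg : IsSocleGenerator p g) {Ω : ι → Finset G} {T : Finset G} (hT : ∀ i, Tiles (Ω i) T)
    {H : AddSubgroup G} (hTH : Equidistributed p g H T) (hcard : #T = p) : CommonPT Ω := by
  obtain ⟨t, ht, t', ht', hne⟩ := Finset.one_lt_card.1 (hcard.symm ▸ hp.one_lt : 1 < #T)
  have hd : p • (t' - t) = 0 := by
    have h1 := hTH.le_card_coset hp hg.nsmul_eq_zero ht
    have h2 : {f ∈ T | p • (f - t) = 0} = T :=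
      Finset.eq_of_subset_of_card_le (Finset.filter_subset _ _) (by omega)
    rw [← h2] at ht'
    exact (Finset.mem_filter.1 ht').2
  set d := t' - t with hddef
  have hd0 : d ≠ 0 := sub_ne_zero.2 hne.symm
  have := Fact.mk hp
  have hord : addOrderOf d = p := addOrderOf_eq_prime hd hd0
  refine Or.inr ⟨(Finset.range p).image (· • d), ⟨d, hd0, ?_⟩, fun i => Tiles.of_inj ?_ ?_⟩
  · intro f hf
    obtain ⟨j, hj, rfl⟩ := Finset.mem_image.1 hf
    refine Finset.mem_image.2 ⟨(j + 1) % p, Finset.mem_range.2 (Nat.mod_lt _ hp.pos), ?_⟩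
    rw [← hord, mod_addOrderOf_nsmul, succ_nsmul]
  · have key : ∀ w ∈ Ω i, ∀ w' ∈ Ω i, ∀ a b : ℕ, a ≤ b → b < p → w + a • d = w' + b • d →
        w = w' := by
      intro w hw w' hw' a b hab hb he
      rcases hab.eq_or_lt with rfl | hab
      · exact add_right_cancel he
      refine (hT i).eq_of_add_nsmul_eq (k := b - a) (by omega) ?_ hw hw' ht ht' ?_
      · rw [hcard]
        exact (Nat.coprime_of_lt_prime (by omega) (by omega) hp).symm
      · have h5 : b • d = (b - a) • d + a • d := by rw [← add_nsmul]; congr 1; omega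
        rw [h5, ← add_assoc] at he
        have h6 := add_right_cancel he
        rw [h6, hddef, nsmul_sub]
        abel
    intro w hw w' hw' u hu u' hu' he
    obtain ⟨a, ha, rfl⟩ := Finset.mem_image.1 hu
    obtain ⟨b, hb, rfl⟩ := Finset.mem_image.1 hu'
    rw [Finset.mem_range] at ha hb
    have : w = w' := by
      rcases le_total a b with hab | hab
      · exact key w hw w' hw' a b hab hb he
      · exact (key w' hw' w hw b a hab ha he.symm).symm
    subst this
    exact ⟨rfl, add_left_cancel he⟩
  · rw [← (hT i).card_mul, Finset.card_image_of_injOn]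
    · simp [hcard]
    · intro a ha b hb hab
      simp only [Finset.coe_range, Set.mem_Iio] at ha hb
      exact nsmul_injOn_Iio_addOrderOf (by simpa [hord] using ha) (by simpa [hord] using hb) hab

/-- If there are at most `p ^ 2` elements of order at most `p`, representatives of `T` modulo the
`p`-torsion subgroup can be thickened to a common complement: as `T` has at least `p` points in each
coset it meets, there are at most `#T / p` representatives. -/
lemma commonPT_of_card_torsion_le {p : ℕ} (hp : p.Prime) {g : G}
    (hg : IsSocleGenerator p g) {Ω : ι → Finset G} {T : Finset G} (hT : ∀ i, Tiles (Ω i) T)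
    {H H' : AddSubgroup G} (hΩ : ∀ i, Equidistributed p g H (Ω i))
    (hTH : Equidistributed p g H' T) (hK : #{x : G | p • x = 0} ≤ p ^ 2) : CommonPT Ω := by
  obtain ⟨E, hEF, hE1, hE2⟩ := exists_representatives p T
  refine commonPT_of_equidistributed hg hΩ E ?_ ?_
  · intro i y
    obtain ⟨w, hw, t, ht, rfl⟩ := (hT i).exists_add_eq y
    obtain ⟨e, he, hte⟩ := hE1 t ht
    exact ⟨w, hw, e, he, by rw [← hte]; congr 1; abel⟩
  · intro i
    have h1 := card_representatives_mul_le hEF hE2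
      (fun x hx => hTH.le_card_coset hp hg.nsmul_eq_zero hx)
    have h2 := (hΩ i).card_subgroup hp hg.nsmul_eq_zero
    have h3 : #{x : G | x ∈ H} ≤ p := by
      rw [← h2, sq] at hK
      exact Nat.le_of_mul_le_mul_left hK hp.pos
    calc #(Ω i) * (#E * #{x : G | x ∈ H}) ≤ #(Ω i) * (#E * p) := by gcongr
      _ ≤ #(Ω i) * #T := by gcongr
      _ = _ := (hT i).card_mul

/-! ### Subgroups of exponent two -/

/-- The subgroup generated by `P` and an element `u` of order at most two. -/
def adjoin (P : AddSubgroup G) (u : G) (hu : u + u = 0) : AddSubgroup G where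
  carrier := {x | x ∈ P ∨ x + u ∈ P}
  zero_mem' := Or.inl P.zero_mem
  add_mem' {x y} hx hy := by
    rcases hx with hx | hx <;> rcases hy with hy | hy
    · exact Or.inl (P.add_mem hx hy)
    · exact Or.inr (by convert P.add_mem hx hy using 1; abel)
    · exact Or.inr (by convert P.add_mem hx hy using 1; abel)
    · exact Or.inl (by
        convert P.add_mem hx hy using 1
        linear_combination (norm := abel) -hu)
  neg_mem' {x} hx := by
    rcases hx with hx | hx
    · exact Or.inl (P.neg_mem hx)
    · exact Or.inr (by
        convert P.neg_mem hx using 1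
        linear_combination (norm := abel) hu)

lemma mem_adjoin {P : AddSubgroup G} {u : G} {hu : u + u = 0} {x : G} :
    x ∈ adjoin P u hu ↔ x ∈ P ∨ x + u ∈ P := Iff.rfl

/-- The number of elements of a subgroup. -/
noncomputable abbrev size (P : AddSubgroup G) : ℕ := #{x : G | x ∈ P}

lemma card_thicken_eq {E : Finset G} {P : AddSubgroup G}
    (hE : ∀ e ∈ E, ∀ e' ∈ E, e - e' ∈ P → e = e') : #(thicken E P) = #E * size P := by
  rw [← Finset.card_product]
  refine (Finset.card_bij (fun x _ => x.1 + x.2) ?_ ?_ ?_).symm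
  · rintro ⟨e, x⟩ h
    simp only [Finset.mem_product, Finset.mem_filter, Finset.mem_univ, true_and] at h
    exact mem_thicken.2 ⟨e, h.1, by simpa using h.2⟩
  · rintro ⟨e, x⟩ h ⟨e', x'⟩ h' he
    simp only [Finset.mem_product, Finset.mem_filter, Finset.mem_univ, true_and] at h h' he
    have h1 : e = e' := by
      apply hE e h.1 e' h'.1
      convert P.sub_mem h'.2 h.2 using 1
      linear_combination (norm := abel) he
    subst h1
    simp [add_left_cancel he]
  · intro x hx
    obtain ⟨e, he, h⟩ := mem_thicken.1 hx
    exact ⟨(e, x - e), by simp [he, h], by simp⟩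

lemma size_adjoin {P : AddSubgroup G} {u : G} (hu : u + u = 0) (huP : u ∉ P) :
    size (adjoin P u hu) = 2 * size P := by
  have h1 : ({x : G | x ∈ adjoin P u hu} : Finset G) = thicken {0, u} P := by
    ext x
    simp only [Finset.mem_filter, Finset.mem_univ, true_and, mem_thicken, mem_adjoin,
      Finset.mem_insert, Finset.mem_singleton, exists_eq_or_imp, exists_eq_left, sub_zero]
    have : x + u = x - u := by linear_combination (norm := abel) hu
    rw [this]
  have hu0 : u ≠ 0 := by rintro rfl; exact huP P.zero_mem
  rw [size, h1, card_thicken_eq, Finset.card_pair hu0.symm]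
  simp only [Finset.mem_insert, Finset.mem_singleton]
  rintro e (rfl | rfl) e' (rfl | rfl) h
  · rfl
  · exact absurd (by simpa using P.neg_mem h) huP
  · exact absurd (by simpa using h) huP
  · rfl

lemma size_bot : size (⊥ : AddSubgroup G) = 1 := by
  exact Finset.card_eq_one.2 ⟨0, by ext; simp⟩

/-- If `P` has index four in the subgroup of elements of order at most two, then `adjoin P u` has
index two in it. -/
lemma sub_mem_adjoin {P : AddSubgroup G} (hP : ∀ x ∈ P, x + x = 0)
    (hcard : 4 * size P = #{x : G | x + x = 0}) {u : G} (hu : u + u = 0) (huP : u ∉ P) {k k' : G}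
    (hk : k + k = 0) (hk' : k' + k' = 0) (hkP : k ∉ adjoin P u hu) (hkP' : k' ∉ adjoin P u hu) :
    k - k' ∈ adjoin P u hu := by
  by_contra hkk
  have hL : ∀ x ∈ adjoin P u hu, x + x = 0 := by
    rintro x (hx | hx)
    · exact hP x hx
    · have := hP _ hx
      linear_combination (norm := abel) this - hu
  have h0 : k ≠ 0 := by rintro rfl; exact hkP (zero_mem _)
  have h0' : k' ≠ 0 := by rintro rfl; exact hkP' (zero_mem _)
  have hne : k ≠ k' := by rintro rfl; exact hkk (by simp [zero_mem])
  have h1 : #(thicken {0, k, k'} (adjoin P u hu)) = 3 * size (adjoin P u hu) := by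
    rw [card_thicken_eq]
    · rw [Finset.card_insert_of_notMem (by simp [h0.symm, h0'.symm]), Finset.card_pair hne]
    · simp only [Finset.mem_insert, Finset.mem_singleton]
      rintro e (rfl | rfl | rfl) e' (rfl | rfl | rfl) h
      · rfl
      · exact absurd (by simpa using neg_mem h) hkP
      · exact absurd (by simpa using neg_mem h) hkP'
      · exact absurd (by simpa using h) hkP
      · rfl
      · exact absurd h hkk
      · exact absurd (by simpa using h) hkP'
      · exact absurd (by simpa using neg_mem h) hkk
      · rfl
  have h2 : thicken {0, k, k'} (adjoin P u hu) ⊆ ({x : G | x + x = 0} : Finset G) := by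
    intro x hx
    obtain ⟨e, he, hxe⟩ := mem_thicken.1 hx
    simp only [Finset.mem_insert, Finset.mem_singleton] at he
    have h3 := hL _ hxe
    have h4 : e + e = 0 := by rcases he with rfl | rfl | rfl <;> simp [hk, hk']
    simp only [Finset.mem_filter, Finset.mem_univ, true_and]
    linear_combination (norm := abel) h3 + h4
  have h3 := Finset.card_le_card h2
  rw [h1, size_adjoin hu huP, ← hcard] at h3
  have h4 : 0 < size P := Finset.card_pos.2 ⟨0, by simp [P.zero_mem]⟩
  omega

/-! ### Quadruples -/

/-- The sum of `{0, a}` and `{0, b}`. -/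
noncomputable def quad (a b : G) : Finset G := {0, a, b, a + b}

lemma mem_quad {a b x : G} : x ∈ quad a b ↔ x = 0 ∨ x = a ∨ x = b ∨ x = a + b := by
  simp [quad]

lemma card_quad_le (a b : G) : #(quad a b) ≤ 4 := by
  unfold quad
  exact Finset.card_le_four

/-- Membership in `T + {0, a}`, for `a` of order two. -/
def Sat (T : Finset G) (a x : G) : Prop := x ∈ T ∨ x + a ∈ T

/-- The set `T` is a tiling complement of `{0, a} + {0, b}`, where `a` has order two. -/
structure QuadTiling (T : Finset G) (a b : G) : Prop where
  ne_zero : a ≠ 0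
  add_self : a + a = 0
  tiles : Tiles (quad a b) T

namespace QuadTiling
variable {T : Finset G} {a b : G}

lemma add_notMem (h : QuadTiling T a b) {t : G} (ht : t ∈ T) : t + a ∉ T := by
  intro h1
  have := h.tiles.eq_and_eq (w := a) (w' := 0) (by simp [mem_quad]) (by simp [mem_quad]) ht h1
    (by abel)
  exact h.ne_zero this.1

lemma sat_add_left (h : QuadTiling T a b) {x : G} : Sat T a (x + a) ↔ Sat T a x := by
  have : x + a + a = x := by rw [add_assoc, h.add_self, add_zero]
  rw [Sat, this, or_comm, Sat]

/-- Translation by `b` exchanges `T + {0, a}` with its complement. -/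
lemma sat_add_right (h : QuadTiling T a b) (hb : b ≠ 0) (hab : a ≠ b) (x : G) :
    Sat T a (x + b) ↔ ¬ Sat T a x := by
  have ha := h.add_self
  have hq0 : (0 : G) ∈ quad a b := by simp [mem_quad]
  have hqa : a ∈ quad a b := by simp [mem_quad]
  have hqb : b ∈ quad a b := by simp [mem_quad]
  have hqab : a + b ∈ quad a b := by simp [mem_quad]
  have hab0 : a + b ≠ a := by simpa using hb
  have hab1 : a + b ≠ 0 := by
    intro h1
    apply hab
    linear_combination (norm := abel) ha - h1
  constructor
  · rintro (h1 | h1) (h2 | h2)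
    · exact hb (h.tiles.eq_and_eq hqb hq0 h2 h1 (by abel)).1
    · exact hab1 (h.tiles.eq_and_eq hqab hq0 h2 h1
        (by linear_combination (norm := abel) ha)).1
    · exact hab1 (h.tiles.eq_and_eq hqab hq0 h2 h1 (by abel)).1
    · exact hb (h.tiles.eq_and_eq hqb hq0 h2 h1 (by abel)).1
  · intro h1
    obtain ⟨w, hw, t, ht, he⟩ := h.tiles.exists_add_eq (x + b)
    rcases mem_quad.1 hw with rfl | rfl | rfl | rfl
    · exact Or.inl (by rw [← he]; simpa using ht)
    · exact Or.inr (by convert ht using 1; linear_combination (norm := abel) ha - he)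
    · exact absurd (Or.inl (by convert ht using 1; linear_combination (norm := abel) - he)) h1
    · exact absurd (Or.inr (by convert ht using 1; linear_combination (norm := abel) ha - he)) h1

lemma right_ne_zero (h : QuadTiling T a b) (hcard : #(quad a b) = 4) : b ≠ 0 := by
  rintro rfl
  have : quad a (0 : G) ⊆ {0, a} := by
    intro x hx
    simp only [mem_quad, add_zero] at hx
    simp only [Finset.mem_insert, Finset.mem_singleton]
    tauto
  have := (Finset.card_le_card this).trans Finset.card_le_two
  omega

lemma left_ne_right (h : QuadTiling T a b) (hcard : #(quad a b) = 4) : a ≠ b := by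
  rintro rfl
  have : quad a a ⊆ {0, a} := by
    intro x hx
    simp only [mem_quad, h.add_self] at hx
    simp only [Finset.mem_insert, Finset.mem_singleton]
    tauto
  have := (Finset.card_le_card this).trans Finset.card_le_two
  omega

end QuadTiling

/-- The nonzero elements of `P` are differences of elements of `T`. -/
def DiffIn (P : AddSubgroup G) (T : Finset G) : Prop :=
  ∀ x ∈ P, x ≠ 0 → ∃ t ∈ T, ∃ t' ∈ T, x = t - t'

/-- If `{0, a} + {0, b}` has exponent two and the nonzero elements of a subgroup `P` of exponent two
and complementary size are differences of elements of a tiling complement of it, then the union of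
one coset of `P` in each coset of the two-torsion subgroup is a tiling complement, too. -/
lemma tiles_thicken_of_torsion {T : Finset G} {a b : G} (h : QuadTiling T a b)
    (hquad : #(quad a b) = 4) (hb : b + b = 0) {P : AddSubgroup G} (hP : ∀ x ∈ P, x + x = 0)
    (hPT : DiffIn P T)
    (hcard : 4 * size P = #{x : G | x + x = 0}) {E : Finset G}
    (hE : ∀ y : G, ∃ e ∈ E, (y - e) + (y - e) = 0) (hEcard : 4 * (#E * size P) ≤ Fintype.card G) :
    Tiles (quad a b) (thicken E P) := by
  have ha := h.add_self
  have hq2 : ∀ v ∈ quad a b, v + v = 0 := by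
    intro v hv
    rcases mem_quad.1 hv with rfl | rfl | rfl | rfl
    · simp
    · exact ha
    · exact hb
    · linear_combination (norm := abel) ha + hb
  have hinj : ∀ v ∈ quad a b, ∀ v' ∈ quad a b, ∀ x ∈ P, ∀ x' ∈ P, v + x = v' + x' →
      v = v' ∧ x = x' := by
    intro v hv v' hv' x hx x' hx' he
    by_cases hxx : x - x' = 0
    · have := sub_eq_zero.1 hxx
      subst this
      exact ⟨add_right_cancel he, rfl⟩
    · obtain ⟨t, ht, t', ht', h1⟩ := hPT _ (P.sub_mem hx hx') hxx
      have := (h.tiles.eq_and_eq hv hv' ht ht'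
        (by linear_combination (norm := abel) he - h1)).1
      subst this
      exact ⟨rfl, add_left_cancel he⟩
  have himg : (quad a b ×ˢ ({x : G | x ∈ P} : Finset G)).image (fun x => x.1 + x.2)
      = ({x : G | x + x = 0} : Finset G) := by
    apply Finset.eq_of_subset_of_card_le
    · intro y hy
      obtain ⟨⟨v, x⟩, hvx, rfl⟩ := Finset.mem_image.1 hy
      simp only [Finset.mem_product, Finset.mem_filter, Finset.mem_univ, true_and] at hvx ⊢
      have h1 := hq2 v hvx.1
      have h2 := hP x hvx.2
      linear_combination (norm := abel) h1 + h2
    · rw [Finset.card_image_of_injOn, Finset.card_product, hquad, hcard]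
      rintro ⟨v, x⟩ hvx ⟨v', x'⟩ hvx' he
      simp only [Finset.coe_product, Set.mem_prod, Finset.mem_coe, Finset.mem_filter,
        Finset.mem_univ, true_and] at hvx hvx'
      have := hinj v hvx.1 v' hvx'.1 x hvx.2 x' hvx'.2 he
      ext <;> simp [this]
  refine Tiles.of_exists ?_ ?_
  · intro y
    obtain ⟨e, he, hye⟩ := hE y
    have h1 : y - e ∈ ({x : G | x + x = 0} : Finset G) := by simpa using hye
    rw [← himg, Finset.mem_image] at h1
    obtain ⟨⟨v, x⟩, hvx, hv⟩ := h1
    simp only [Finset.mem_product, Finset.mem_filter, Finset.mem_univ, true_and] at hvx hv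
    exact ⟨v, hvx.1, x + e, mem_thicken.2 ⟨e, he, by simpa using hvx.2⟩,
      by linear_combination (norm := abel) hv⟩
  · rw [hquad]
    exact (Nat.mul_le_mul_left _ (card_thicken_le E P)).trans hEcard

/-- A criterion for the union of one coset of `P` in each coset of the two-torsion subgroup to be a
tiling complement of `{0, a} + {0, b}`: with `L` the subgroup generated by `P` and `a`, of index two
in the two-torsion subgroup, translation by `b` never matches the cosets of `L`. -/
lemma tiles_thicken_of_notMem {a b : G} (ha : a + a = 0)
    {P : AddSubgroup G} (hP : ∀ x ∈ P, x + x = 0)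
    (hcard : 4 * size P = #{x : G | x + x = 0}) (haP : a ∉ P) {E : Finset G}
    (hE : ∀ y : G, ∃ e ∈ E, (y - e) + (y - e) = 0) (hEcard : 4 * (#E * size P) ≤ Fintype.card G)
    (hEb : ∀ e ∈ E, ∀ e' ∈ E, (e' + b - e) + (e' + b - e) = 0 → e' + b - e ∉ adjoin P a ha) :
    Tiles (quad a b) (thicken E P) := by
  have hL : ∀ y, ∀ e ∈ E, y - e ∈ adjoin P a ha →
      ∃ w, (w = 0 ∨ w = a) ∧ ∃ t ∈ thicken E P, w + t = y := by
    rintro y e he (h | h)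
    · exact ⟨0, Or.inl rfl, y, mem_thicken.2 ⟨e, he, h⟩, by simp⟩
    · refine ⟨a, Or.inr rfl, y + a, mem_thicken.2 ⟨e, he, by convert h using 1; abel⟩, ?_⟩
      linear_combination (norm := abel) ha
  refine Tiles.of_exists ?_ ?_
  · intro y
    obtain ⟨e, he, hye⟩ := hE y
    obtain ⟨e', he', hye'⟩ := hE (y - b)
    by_cases h1 : y - e ∈ adjoin P a ha
    · obtain ⟨w, hw, t, ht, h2⟩ := hL y e he h1
      exact ⟨w, mem_quad.2 (by tauto), t, ht, h2⟩
    · have h2 : (e' + b - e) + (e' + b - e) = 0 := by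
        linear_combination (norm := abel) hye - hye'
      have h3 := sub_mem_adjoin hP hcard ha haP hye h2 h1 (hEb e he e' he' h2)
      obtain ⟨w, hw, t, ht, h4⟩ := hL (y - b) e' he' (by convert h3 using 1; abel)
      refine ⟨w + b, mem_quad.2 ?_, t, ht, by linear_combination (norm := abel) h4⟩
      rcases hw with rfl | rfl <;> simp
  · exact (Nat.mul_le_mul (card_quad_le a b) (card_thicken_le E P)).trans hEcard

/-! ### Four-point sets in two-groups -/

lemma char_eq_one_or_neg_one (χ : AddChar G ℂ) {a : G} (ha : a + a = 0) : χ a = 1 ∨ χ a = -1 := by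
  have h1 : χ a * χ a = 1 := by rw [← AddChar.map_add_eq_mul, ha, AddChar.map_zero_eq_one]
  exact mul_self_eq_one_iff.1 h1

/-- An equidistributed set of four points is either of the form `x + {0, a} + {0, b}` with `a` of
order two, or there is `k ≠ 0` on which all characters whose sum over the set vanishes are
trivial. Namely, the set is `{s, s + a, c, d}` with `a` and `c - d` of order two, and
`k = a + c - d`. -/
lemma four_points {g : G} (hg : 2 • g = 0) {H : AddSubgroup G} {F : Finset G}
    (hF : Equidistributed 2 g H F) (hcard : #F = 4) :
    (∃ x a b, a ≠ 0 ∧ a + a = 0 ∧ F = (quad a b).image (x + ·)) ∨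
      ∃ k : G, k ≠ 0 ∧ ∀ χ : AddChar G ℂ, ∑ f ∈ F, χ f = 0 → χ k = 1 := by
  have heven : ∀ x ∈ F, ∃ n, #{f ∈ F | 2 • (f - x) = 0} = 2 * n := fun x hx =>
    ⟨_, (hF.card_coset Nat.prime_two hg x).symm⟩
  have hge := fun x (hx : x ∈ F) => hF.le_card_coset Nat.prime_two hg hx
  have hmate : ∀ x ∈ F, ∃ y ∈ F, y ≠ x ∧ 2 • (y - x) = 0 := by
    intro x hx
    obtain ⟨y, hy, hne⟩ := Finset.exists_mem_ne (lt_of_lt_of_le one_lt_two (hge x hx)) x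
    rw [Finset.mem_filter] at hy
    exact ⟨y, hy.1, hne, hy.2⟩
  obtain ⟨s, hs⟩ : F.Nonempty := Finset.card_pos.1 (by omega)
  obtain ⟨t, ht, hts, hta⟩ := hmate s hs
  have hR : #((F.erase s).erase t) = 2 := by
    rw [Finset.card_erase_of_mem (by simp [ht, hts]), Finset.card_erase_of_mem hs, hcard]
  obtain ⟨c, d, hcd, hR⟩ := Finset.card_eq_two.1 hR
  have hcF : c ∈ (F.erase s).erase t := by rw [hR]; simp
  have hdF : d ∈ (F.erase s).erase t := by rw [hR]; simp
  simp only [Finset.mem_erase] at hcF hdF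
  have hFeq : F = {s, t, c, d} := by
    rw [← hR, Finset.insert_erase (by simp [ht, hts]), Finset.insert_erase hs]
  have h2 : 2 • (c - d) = 0 := by
    obtain ⟨y, hy, hyc, h1⟩ := hmate c hcF.2.2
    rw [hFeq] at hy
    simp only [Finset.mem_insert, Finset.mem_singleton] at hy
    -- If the mate of `c` is `s` or `t`, the coset of `c` has at least three, hence four points.
    have hall : 2 • (s - c) = 0 → 2 • (c - d) = 0 := by
      intro h3
      obtain ⟨n, hn⟩ := heven c hcF.2.2
      have h4 : ({s, t, c} : Finset G) ⊆ {f ∈ F | 2 • (f - c) = 0} := by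
        intro f hf
        simp only [Finset.mem_insert, Finset.mem_singleton] at hf
        rw [Finset.mem_filter]
        rcases hf with rfl | rfl | rfl
        · exact ⟨hs, h3⟩
        · exact ⟨ht, by linear_combination (norm := module) h3 + hta⟩
        · exact ⟨hcF.2.2, by simp⟩
      have h5 := Finset.card_le_card h4
      rw [Finset.card_eq_three.2 ⟨s, t, c, hts.symm, hcF.2.1.symm, hcF.1.symm, rfl⟩, hn] at h5
      have h6 : {f ∈ F | 2 • (f - c) = 0} = F :=
        Finset.eq_of_subset_of_card_le (Finset.filter_subset _ _) (by omega)
      have h7 := hdF.2.2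
      rw [← h6, Finset.mem_filter] at h7
      linear_combination (norm := module) -h7.2
    rcases hy with rfl | rfl | rfl | rfl
    · exact hall h1
    · exact hall (by linear_combination (norm := module) h1 - hta)
    · exact absurd rfl hyc
    · linear_combination (norm := module) -h1
  have ha' : (t - s) + (t - s) = 0 := by rw [← two_nsmul, hta]
  have hcd' : (c - d) + (c - d) = 0 := by rw [← two_nsmul, h2]
  by_cases hk : t - s + (c - d) = 0
  · left
    refine ⟨s, t - s, c - s, sub_ne_zero.2 hts, ha', ?_⟩
    rw [hFeq]
    have h8 : s + (t - s + (c - s)) = d := by linear_combination (norm := abel) hk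
    ext x
    simp [quad, h8]
  · right
    refine ⟨_, hk, fun χ hχ => ?_⟩
    rw [hFeq, Finset.sum_insert (by simp [hts.symm, hcF.2.1.symm, hdF.2.1.symm]),
      Finset.sum_insert (by simp [hcF.1.symm, hdF.1.symm]), Finset.sum_pair hcd] at hχ
    have e1 : χ t = χ s * χ (t - s) := by rw [← AddChar.map_add_eq_mul]; congr 1; abel
    have e2 : χ c = χ d * χ (c - d) := by rw [← AddChar.map_add_eq_mul]; congr 1; abel
    have hs0 := (χ.val_isUnit s).ne_zero
    have hd0 := (χ.val_isUnit d).ne_zero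
    rw [AddChar.map_add_eq_mul]
    rw [e1, e2] at hχ
    rcases char_eq_one_or_neg_one χ ha' with h3 | h3 <;>
      rcases char_eq_one_or_neg_one χ hcd' with h4 | h4 <;> rw [h3, h4] at hχ ⊢
    · norm_num
    · exfalso
      apply hs0
      linear_combination hχ / 2
    · exfalso
      apply hd0
      linear_combination hχ / 2
    · norm_num

/-- The case of a complement of four points in a two-group: either `T` is invariant under
translation by some `a`, or the `Ω i` are invariant under translation by some `k`. -/
lemma commonPT_of_tiles_card_eq_four {g : G} (hg : IsSocleGenerator 2 g) {Ω : ι → Finset G}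
    {T : Finset G} (hT : ∀ i, Tiles (Ω i) T) {H : AddSubgroup G} (hTH : Equidistributed 2 g H T)
    (hcard : #T = 4) : CommonPT Ω := by
  rcases four_points hg.nsmul_eq_zero hTH hcard with ⟨x, a, b, ha0, ha, rfl⟩ | ⟨k, hk, h⟩
  · refine Or.inr ⟨_, ⟨a, ha0, ?_⟩, hT⟩
    intro f hf
    obtain ⟨v, hv, rfl⟩ := Finset.mem_image.1 hf
    refine Finset.mem_image.2 ⟨v + a, ?_, by abel⟩
    rcases mem_quad.1 hv with rfl | rfl | rfl | rfl <;> rw [mem_quad]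
    · simp
    · simp [ha]
    · right; right; right; abel
    · right; right; left; linear_combination (norm := abel) ha
  · refine Or.inl ⟨k, hk, fun i w hw => add_mem_of_char_sum (fun χ hχ => ?_) hw⟩
    have hne : χ ≠ 0 := by rintro rfl; simp at hχ
    exact (mul_eq_zero.1 ((hT i).char_sum_mul hne)).resolve_right fun h1 => hχ (h χ h1)

/-! ### Difference subgroups inside a tiling complement -/

lemma add_self_of_mem_adjoin {P : AddSubgroup G} (hP : ∀ x ∈ P, x + x = 0) {u : G}
    {hu : u + u = 0} : ∀ x ∈ adjoin P u hu, x + x = 0 := by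
  rintro x (hx | hx)
  · exact hP x hx
  · have := hP _ hx
    linear_combination (norm := abel) this - hu

/-- If a coset of `P` is contained in `T`, adjoining the difference with a further element of `T`
yields a subgroup whose nonzero elements are differences of elements of `T`. -/
lemma diffIn_adjoin {T : Finset G} {P : AddSubgroup G} (hP : ∀ x ∈ P, x + x = 0) {q u : G}
    (hq : ∀ x ∈ P, q + x ∈ T) (hu : u + u = 0) (huT : q + u ∈ T) : DiffIn (adjoin P u hu) T := by
  rintro x (hx | hx) -
  · exact ⟨q + x, hq x hx, q, by simpa using hq 0 P.zero_mem, by abel⟩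
  · refine ⟨q + u, huT, q + (x + u), hq _ hx, ?_⟩
    have := hP _ hx
    linear_combination (norm := abel) this - hu

lemma mem_bot_adjoin {u x : G} {hu : u + u = 0} : x ∈ adjoin ⊥ u hu ↔ x = 0 ∨ x = u := by
  rw [mem_adjoin, AddSubgroup.mem_bot, AddSubgroup.mem_bot]
  refine or_congr Iff.rfl ⟨fun h => ?_, fun h => by rw [h, hu]⟩
  linear_combination (norm := abel) h - hu

lemma mem_bot_adjoin_adjoin {u v x : G} {hu : u + u = 0} {hv : v + v = 0} :
    x ∈ adjoin (adjoin ⊥ u hu) v hv ↔ x = 0 ∨ x = u ∨ x = v ∨ x = u + v := by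
  rw [mem_adjoin, mem_bot_adjoin, mem_bot_adjoin, or_assoc]
  refine or_congr Iff.rfl (or_congr Iff.rfl (or_congr ?_ ?_))
  · exact ⟨fun h => by linear_combination (norm := abel) h - hv, fun h => by rw [h, hv]⟩
  · exact ⟨fun h => by linear_combination (norm := abel) h - hv,
      fun h => by linear_combination (norm := abel) h + hv⟩

lemma add_self_of_mem_bot : ∀ x ∈ (⊥ : AddSubgroup G), x + x = 0 := by
  intro x hx
  simp [AddSubgroup.mem_bot.1 hx]

lemma exists_mem_coset_notMem {T : Finset G} {t : G} {S : Finset G}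
    (h : #S < #{f ∈ T | (f - t) + (f - t) = 0}) :
    ∃ u, u + u = 0 ∧ t + u ∈ T ∧ t + u ∉ S := by
  obtain ⟨f, hf, hfS⟩ := Finset.exists_mem_notMem_of_card_lt_card h
  rw [Finset.mem_filter] at hf
  exact ⟨f - t, hf.2, by simpa using hf.1, by simpa using hfS⟩

/-- If `T` has at least two points in a coset of the two-torsion subgroup, some subgroup of order
two has its nonzero element among the differences of `T`. -/
lemma exists_diffIn_two {T : Finset G} {t : G} (ht : t ∈ T)
    (h : 1 < #{f ∈ T | (f - t) + (f - t) = 0}) :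
    ∃ P : AddSubgroup G, (∀ x ∈ P, x + x = 0) ∧ DiffIn P T ∧ size P = 2 := by
  obtain ⟨u, hu, hut, hu0⟩ := exists_mem_coset_notMem (S := {t}) (by simpa using h)
  refine ⟨adjoin ⊥ u hu, add_self_of_mem_adjoin add_self_of_mem_bot,
    diffIn_adjoin add_self_of_mem_bot (q := t) ?_ hu hut, ?_⟩
  · intro x hx
    simpa [AddSubgroup.mem_bot.1 hx] using ht
  · rw [size_adjoin hu, size_bot]
    rw [AddSubgroup.mem_bot]
    rintro rfl
    simp at hu0

lemma exists_diffIn_four {T : Finset G} {t : G} (ht : t ∈ T)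
    (h : 2 < #{f ∈ T | (f - t) + (f - t) = 0}) :
    ∃ P : AddSubgroup G, (∀ x ∈ P, x + x = 0) ∧ DiffIn P T ∧ size P = 4 := by
  obtain ⟨u, hu, hut, hu0⟩ := exists_mem_coset_notMem (T := T) (t := t) (S := {t})
    (by rw [Finset.card_singleton]; omega)
  obtain ⟨v, hv, hvt, hvS⟩ := exists_mem_coset_notMem (S := {t, t + u})
    (lt_of_le_of_lt Finset.card_le_two h)
  simp only [Finset.mem_singleton, Finset.mem_insert, not_or, add_eq_left,
    add_right_inj] at hu0 hvS
  have h1 : size (adjoin ⊥ u hu) = 2 := by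
    rw [size_adjoin hu (by simpa using hu0), size_bot]
  refine ⟨adjoin (adjoin ⊥ u hu) v hv,
    add_self_of_mem_adjoin (add_self_of_mem_adjoin add_self_of_mem_bot),
    diffIn_adjoin (add_self_of_mem_adjoin add_self_of_mem_bot) (q := t) ?_ hv hvt, ?_⟩
  · intro x hx
    rcases mem_bot_adjoin.1 hx with rfl | rfl
    · simpa using ht
    · exact hut
  · rw [size_adjoin hv, h1]
    rw [mem_bot_adjoin]
    tauto

/-- If a set of eight points of an elementary abelian two-group contains an affine plane, the
subgroup generated by the plane and a further point consists of differences. Otherwise, the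
differences of the `28` pairs of points are distinct. -/
lemma exists_diffIn_eight {T : Finset G} (hcard : #T = 8) (h2 : ∀ x : G, x + x = 0) :
    (∃ P : AddSubgroup G, DiffIn P T ∧ size P = 8) ∨
      29 ≤ #{x : G | x = 0 ∨ ∃ t ∈ T, ∃ t' ∈ T, x = t - t'} := by
  by_cases hpl : ∃ q u v, u ≠ 0 ∧ v ≠ 0 ∧ u ≠ v ∧ q ∈ T ∧ q + u ∈ T ∧ q + v ∈ T ∧ q + (u + v) ∈ T
  · left
    obtain ⟨q, u, v, hu0, hv0, huv, hq, hqu, hqv, hquv⟩ := hpl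
    have h1 : size (adjoin ⊥ u (h2 u)) = 2 := by
      rw [size_adjoin _ (by simpa using hu0), size_bot]
    have h3 : size (adjoin (adjoin ⊥ u (h2 u)) v (h2 v)) = 4 := by
      rw [size_adjoin, h1]
      rw [mem_bot_adjoin]
      rintro (h | h)
      · exact hv0 h
      · exact huv h.symm
    obtain ⟨w, hw, hwT, hwS⟩ := exists_mem_coset_notMem (T := T) (t := q)
      (S := {q, q + u, q + v, q + (u + v)}) (by
        have : {f ∈ T | (f - q) + (f - q) = 0} = T := Finset.filter_true_of_mem fun f _ => h2 _
        rw [this, hcard]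
        exact lt_of_le_of_lt Finset.card_le_four (by norm_num))
    refine ⟨adjoin (adjoin (adjoin ⊥ u (h2 u)) v (h2 v)) w hw,
      diffIn_adjoin (fun x _ => h2 x) (q := q) ?_ hw hwT, ?_⟩
    · intro x hx
      rcases mem_bot_adjoin_adjoin.1 hx with rfl | rfl | rfl | rfl
      · simpa using hq
      · exact hqu
      · exact hqv
      · exact hquv
    · rw [size_adjoin, h3]
      rw [mem_bot_adjoin_adjoin]
      rintro (rfl | rfl | rfl | rfl) <;> simp at hwS
  · right
    have h3 : #T.offDiag ≤ 2 * #(T.offDiag.image fun x => x.1 - x.2) := by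
      apply Finset.card_le_mul_card_image
      intro d hd
      obtain ⟨⟨t, t'⟩, htt, rfl⟩ := Finset.mem_image.1 hd
      have : {x ∈ T.offDiag | x.1 - x.2 = t - t'} ⊆ {(t, t'), (t', t)} := by
        rintro ⟨s, s'⟩ hs
        simp only [Finset.mem_filter, Finset.mem_offDiag] at hs htt
        simp only [Finset.mem_insert, Finset.mem_singleton, Prod.mk.injEq]
        obtain ⟨⟨hs, hs', hne⟩, he⟩ := hs
        by_contra hcon
        apply hpl
        have h5 := h2 t
        have h6 := h2 t'
        refine ⟨t, t' - t, s - t, sub_ne_zero.2 htt.2.2.symm, ?_, ?_, htt.1, by simpa using htt.2.1,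
          by simpa using hs, ?_⟩
        · rw [sub_ne_zero]
          rintro rfl
          exact hcon (Or.inl ⟨rfl, by linear_combination (norm := abel) -he⟩)
        · intro h4
          have h7 : s = t' := by linear_combination (norm := abel) -h4
          exact hcon (Or.inr ⟨h7, by linear_combination (norm := abel) h7 - he + h6 - h5⟩)
        · convert hs' using 1
          linear_combination (norm := abel) he
      exact (Finset.card_le_card this).trans Finset.card_le_two
    rw [Finset.offDiag_card, hcard] at h3
    have h4 : insert 0 (T.offDiag.image fun x => x.1 - x.2) ⊆
        ({x : G | x = 0 ∨ ∃ t ∈ T, ∃ t' ∈ T, x = t - t'} : Finset G) := by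
      intro x hx
      simp only [Finset.mem_insert, Finset.mem_image, Finset.mem_offDiag, Prod.exists] at hx
      simp only [Finset.mem_filter, Finset.mem_univ, true_and]
      rcases hx with rfl | ⟨t, t', ⟨ht, ht', -⟩, rfl⟩
      · exact Or.inl rfl
      · exact Or.inr ⟨t, ht, t', ht', rfl⟩
    have h5 := Finset.card_le_card h4
    rw [Finset.card_insert_of_notMem] at h5
    · omega
    · simp only [Finset.mem_image, Finset.mem_offDiag, Prod.exists, not_exists]
      rintro t t' ⟨⟨-, -, hne⟩, h6⟩
      exact hne (sub_eq_zero.1 h6)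

/-- In a group of order `32`, quadruples whose common tiling complement `T` has `29` or more
differences are all equal, as each consists of `0` and the elements which are not differences of
elements of `T`. -/
lemma left_mem_quad {T : Finset G} (hG : Fintype.card G = 32) {a b a' b' : G}
    (hT : QuadTiling T a b) (hT' : QuadTiling T a' b') (hq : #(quad a b) = 4)
    (hD : 29 ≤ #{x : G | x = 0 ∨ ∃ t ∈ T, ∃ t' ∈ T, x = t - t'}) : a' ∈ quad a b := by
  set D : Finset G := {x : G | x = 0 ∨ ∃ t ∈ T, ∃ t' ∈ T, x = t - t'} with hDdef
  have hdisj : ∀ c d : G, QuadTiling T c d → Disjoint ((quad c d).erase 0) D := by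
    intro c d h
    rw [Finset.disjoint_left]
    intro x hx hxD
    rw [Finset.mem_erase] at hx
    simp only [hDdef, Finset.mem_filter, Finset.mem_univ, true_and] at hxD
    rcases hxD with h0 | ⟨t, ht, t', ht', h1⟩
    · exact hx.1 h0
    · apply hx.1
      exact (h.tiles.eq_and_eq hx.2 (w' := 0) (by simp [mem_quad]) ht' ht (by
        rw [h1]; abel)).1
  have h1 : #((quad a b).erase 0) = 3 := by
    rw [Finset.card_erase_of_mem (by simp [mem_quad]), hq]
  have h2 : (quad a b).erase 0 = Dᶜ := by
    apply Finset.eq_of_subset_of_card_le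
    · rw [Finset.subset_compl_iff_disjoint_right]
      exact hdisj a b hT
    · rw [Finset.card_compl, hG]
      omega
  have h3 : a' ∈ Dᶜ := by
    rw [Finset.mem_compl]
    exact Finset.disjoint_left.1 (hdisj a' b' hT')
      (by simp [mem_quad, hT'.ne_zero])
  rw [← h2] at h3
  exact Finset.mem_of_mem_erase h3

/-! ### Families of quadruples -/

/-- A set meeting all cosets of the two-torsion subgroup contains a system of representatives. -/
lemma exists_section (hG : Fintype.card G = 32) (F : Finset G)
    (hF : ∀ y : G, ∃ f ∈ F, (y - f) + (y - f) = 0) :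
    ∃ E ⊆ F, (∀ y : G, ∃ e ∈ E, (y - e) + (y - e) = 0) ∧
      #E * #{x : G | x + x = 0} ≤ 32 := by
  obtain ⟨E, hEF, hE1, hE2⟩ := exists_representatives 2 F
  refine ⟨E, hEF, fun y => ?_, ?_⟩
  · obtain ⟨f, hf, hyf⟩ := hF y
    obtain ⟨e, he, hfe⟩ := hE1 f hf
    exact ⟨e, he, by rw [two_nsmul] at hfe; linear_combination (norm := abel) hyf + hfe⟩
  · have := card_representatives_mul_le (Finset.subset_univ E) hE2 (n := #{y : G | 2 • y = 0})
      (fun x _ => (card_torsion_coset 2 x).ge)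
    rw [Finset.card_univ, hG] at this
    simpa only [two_nsmul] using this

/-- The eight-point set `T` is a common tiling complement of the quadruples `{0, a i} + {0, b i}` in
a group of order `32`. -/
structure QuadFamily (T : Finset G) (a b : ι → G) : Prop where
  card_eq : #T = 8
  card_group : Fintype.card G = 32
  tiling : ∀ i, QuadTiling T (a i) (b i)

namespace QuadFamily
variable {T : Finset G} {a b : ι → G} {g : G}

lemma card_quad (h : QuadFamily T a b) (i : ι) : #(quad (a i) (b i)) = 4 := by
  have := (h.tiling i).tiles.card_mul
  rw [h.card_eq, h.card_group] at this
  omega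

lemma add_self (h : QuadFamily T a b) (i : ι) : a i + a i = 0 := (h.tiling i).add_self

lemma right_ne_zero (h : QuadFamily T a b) (i : ι) : b i ≠ 0 :=
  (h.tiling i).right_ne_zero (h.card_quad i)

lemma sat_add_right (h : QuadFamily T a b) (i : ι) (x : G) :
    Sat T (a i) (x + b i) ↔ ¬ Sat T (a i) x :=
  (h.tiling i).sat_add_right (h.right_ne_zero i) ((h.tiling i).left_ne_right (h.card_quad i)) x

/-- The socle generator is a multiple of `2 • b i`, and translation by `b i` exchanges
`T + {0, a i}` with its complement. So translation by the socle generator preserves `T + {0, a i}`.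
-/
lemma sat_add_socle (h : QuadFamily T a b) (hg : IsSocleGenerator 2 g) {i : ι}
    (hb : b i + b i ≠ 0) (x : G) : Sat T (a i) (x + g) ↔ Sat T (a i) x := by
  obtain ⟨j, hj⟩ := hg.eq_nsmul (b i) (by rwa [two_nsmul])
  have h2 : ∀ x, Sat T (a i) (x + 2 • b i) ↔ Sat T (a i) x := by
    intro x
    rw [two_nsmul, ← add_assoc, h.sat_add_right, h.sat_add_right, not_not]
  rw [hj]
  clear hj
  induction j with
  | zero => simp
  | succ j ih => rw [succ_nsmul, ← add_assoc]; exact (h2 _).trans ih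

lemma commonPT_of_thicken {P : AddSubgroup G} (hP : 1 < size P) {E : Finset G}
    (hE : ∀ i, Tiles (quad (a i) (b i)) (thicken E P)) :
    CommonPT fun i => quad (a i) (b i) := by
  obtain ⟨x, hx, hx0⟩ := Finset.exists_mem_ne hP 0
  exact Or.inr ⟨_, hasPeriod_thicken E (by simpa using hx) hx0, hE⟩

/-- If one of the quadruples has exponent two, then `T` is equidistributed among the cosets of the
two-torsion subgroup. -/
lemma card_coset (h : QuadFamily T a b) {i : ι} (hi : b i + b i = 0) (x : G) :
    4 * #{t ∈ T | (t - x) + (t - x) = 0} = #{x : G | x + x = 0} := by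
  have hq2 : ∀ v ∈ quad (a i) (b i), v + v = 0 := by
    intro v hv
    have ha := h.add_self i
    rcases mem_quad.1 hv with rfl | rfl | rfl | rfl
    · simp
    · exact ha
    · exact hi
    · linear_combination (norm := abel) ha + hi
  rw [← h.card_quad i, ← Finset.card_product]
  refine Finset.card_bij (fun y _ => y.1 + y.2 - x) ?_ ?_ ?_
  · rintro ⟨v, t⟩ hy
    simp only [Finset.mem_product, Finset.mem_filter, Finset.mem_univ, true_and] at hy ⊢
    have h1 := hq2 v hy.1
    linear_combination (norm := abel) h1 + hy.2.2
  · rintro ⟨v, t⟩ hy ⟨v', t'⟩ hy' he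
    simp only [Finset.mem_product, Finset.mem_filter] at hy hy' he
    have := (h.tiling i).tiles.eq_and_eq hy.1 hy'.1 hy.2.1 hy'.2.1 (sub_left_injective he)
    ext <;> simp [this]
  · intro k hk
    obtain ⟨v, hv, t, ht, he⟩ := (h.tiling i).tiles.exists_add_eq (k + x)
    refine ⟨(v, t), ?_, by simp [he]⟩
    simp only [Finset.mem_product, Finset.mem_filter, Finset.mem_univ, true_and] at hk ⊢
    have h1 := hq2 v hv
    exact ⟨hv, ht, by linear_combination (norm := abel) he + he + hk - h1⟩

/-- A sufficient condition for the union of one coset of `P` in each coset of the two-torsion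
subgroup to be a common tiling complement. -/
lemma commonPT_of_diffIn (h : QuadFamily T a b) {P : AddSubgroup G} (hP : ∀ x ∈ P, x + x = 0)
    (hPT : DiffIn P T) (hP1 : 1 < size P) (hcard : 4 * size P = #{x : G | x + x = 0})
    {E : Finset G} (hE : ∀ y : G, ∃ e ∈ E, (y - e) + (y - e) = 0)
    (hEcard : #E * #{x : G | x + x = 0} ≤ 32)
    (hEb : ∀ i, b i + b i ≠ 0 → ∀ e ∈ E, ∀ e' ∈ E, (e' + b i - e) + (e' + b i - e) = 0 →
      e' + b i - e ∉ adjoin P (a i) (h.add_self i)) :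
    CommonPT fun i => quad (a i) (b i) := by
  have hEcard' : 4 * (#E * size P) ≤ Fintype.card G := by
    rw [h.card_group]
    calc 4 * (#E * size P) = #E * (4 * size P) := by ring
      _ ≤ 32 := by rw [hcard]; exact hEcard
  refine commonPT_of_thicken hP1 (E := E) fun i => ?_
  by_cases hi : b i + b i = 0
  · exact tiles_thicken_of_torsion (h.tiling i) (h.card_quad i) hi hP hPT hcard hE hEcard'
  · refine tiles_thicken_of_notMem (h.add_self i) hP hcard ?_ hE hEcard' (hEb i hi)
    intro haP
    obtain ⟨t, ht, t', ht', h1⟩ := hPT _ haP (h.tiling i).ne_zero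
    exact (h.tiling i).add_notMem ht' (by rw [h1]; simpa using ht)

/-- The case where all quadruples have exponent two. -/
lemma commonPT_of_torsion [Nonempty ι] (h : QuadFamily T a b) (hb : ∀ i, b i + b i = 0)
    (hK : #{x : G | x + x = 0} = 8 ∨ #{x : G | x + x = 0} = 16 ∨ #{x : G | x + x = 0} = 32) :
    CommonPT fun i => quad (a i) (b i) := by
  obtain ⟨i₀⟩ := ‹Nonempty ι›
  obtain ⟨t, ht⟩ : T.Nonempty := Finset.card_pos.1 (by rw [h.card_eq]; norm_num)
  have hcount := h.card_coset (hb i₀) t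
  obtain ⟨E, -, hE, hEcard⟩ := exists_section h.card_group Finset.univ
    (fun y => ⟨y, Finset.mem_univ _, by simp⟩)
  have main : ∀ P : AddSubgroup G, (∀ x ∈ P, x + x = 0) → DiffIn P T → 1 < size P →
      4 * size P = #{x : G | x + x = 0} → CommonPT fun i => quad (a i) (b i) :=
    fun P hP hPT h1 h2 => h.commonPT_of_diffIn hP hPT h1 h2 hE hEcard
      fun i hi => absurd (hb i) hi
  rcases hK with hK | hK | hK
  · obtain ⟨P, hP, hPT, hs⟩ := exists_diffIn_two (T := T) ht (by omega)
    exact main P hP hPT (by omega) (by omega)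
  · obtain ⟨P, hP, hPT, hs⟩ := exists_diffIn_four (T := T) ht (by omega)
    exact main P hP hPT (by omega) (by omega)
  · have h2 : ∀ x : G, x + x = 0 := by
      have h3 : ({x : G | x + x = 0} : Finset G) = Finset.univ :=
        Finset.eq_univ_of_card _ (by rw [hK, h.card_group])
      intro x
      have := Finset.mem_univ x
      rw [← h3] at this
      simpa using this
    rcases exists_diffIn_eight h.card_eq h2 with ⟨P, hPT, hs⟩ | hD
    · exact main P (fun x _ => h2 x) hPT (by omega) (by omega)
    · refine Or.inl ⟨a i₀, (h.tiling i₀).ne_zero, fun i w hw => ?_⟩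
      have h4 := left_mem_quad h.card_group (h.tiling i) (h.tiling i₀) (h.card_quad i) hD
      have ha := h2 (a i)
      have hb := h2 (b i)
      rcases mem_quad.1 h4 with h4 | h4 | h4 | h4 <;> rw [h4] <;>
        rcases mem_quad.1 hw with rfl | rfl | rfl | rfl <;> rw [mem_quad] <;> grind

/-- If all quadruples have `a i = g`, then `g` is a common period. -/
lemma commonPT_of_left_eq (h : QuadFamily T a b) (hg : IsSocleGenerator 2 g)
    (hag : ∀ i, a i = g) : CommonPT fun i => quad (a i) (b i) := by
  refine Or.inl ⟨g, hg.ne_zero, fun i w hw => ?_⟩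
  have ha := h.add_self i
  rw [← hag i]
  rcases mem_quad.1 hw with rfl | rfl | rfl | rfl <;> rw [mem_quad] <;> grind

/-- If `g` is not a difference of elements of `T`, but `a i ≠ g` for some quadruple of larger
exponent, then `T` is invariant under translation by `g + a i`. -/
lemma commonPT_of_notMem (h : QuadFamily T a b) (hg : IsSocleGenerator 2 g) {i : ι}
    (hb : b i + b i ≠ 0) (hag : a i ≠ g) (hT : ∀ t ∈ T, t + g ∉ T) :
    CommonPT fun i => quad (a i) (b i) := by
  refine Or.inr ⟨T, ⟨g + a i, ?_, fun t ht => ?_⟩, fun i => (h.tiling i).tiles⟩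
  · intro h0
    apply hag
    have := h.add_self i
    have hgg := hg.nsmul_eq_zero
    rw [two_nsmul] at hgg
    linear_combination (norm := abel) h0 - hgg
  · rcases (h.sat_add_socle hg hb t).2 (Or.inl ht) with h1 | h1
    · exact absurd h1 (hT t ht)
    · rwa [← add_assoc]

/-- A variant of `QuadFamily.commonPT_of_diffIn` for transversals contained in `T`: in place of the
condition on the differences, it suffices that cosets of `P` are contained in `T + {0, a i}`. -/
lemma commonPT_of_socle_mem (h : QuadFamily T a b) {P : AddSubgroup G} (hP : ∀ x ∈ P, x + x = 0)
    (hPT : DiffIn P T) (hP1 : 1 < size P) (hcard : 4 * size P = #{x : G | x + x = 0})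
    {E : Finset G} (hET : E ⊆ T) (hE : ∀ y : G, ∃ e ∈ E, (y - e) + (y - e) = 0)
    (hEcard : #E * #{x : G | x + x = 0} ≤ 32)
    (hEb : ∀ i, b i + b i ≠ 0 → ∀ e ∈ E, ∀ e' ∈ E, (e' + b i - e) + (e' + b i - e) = 0 →
      (∀ x ∈ P, Sat T (a i) (e + x)) ∨ ∀ x ∈ P, Sat T (a i) (e' + x)) :
    CommonPT fun i => quad (a i) (b i) := by
  refine h.commonPT_of_diffIn hP hPT hP1 hcard hE hEcard fun i hi e he e' he' h0 hmem => ?_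
  have ha := h.add_self i
  have hsat : ∀ y, Sat T (a i) (y + a i) ↔ Sat T (a i) y := fun y => (h.tiling i).sat_add_left
  rcases hEb i hi e he e' he' h0 with hS | hS
  · -- `e' + b i` lies in `e + P + {0, a i}`, so it is covered, and `e'` is not
    have h1 : Sat T (a i) (e' + b i) := by
      rcases hmem with hm | hm
      · simpa using hS _ hm
      · have := hS _ hm
        rw [show e + (e' + b i - e + a i) = e' + b i + a i by abel, hsat] at this
        exact this
    exact (h.sat_add_right i e').1 h1 (Or.inl (hET he'))
  · have h1 : Sat T (a i) (e - b i) := by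
      rcases hmem with hm | hm
      · have := hS _ (P.neg_mem hm)
        rwa [show e' + -(e' + b i - e) = e - b i by abel] at this
      · have := hS _ (P.neg_mem hm)
        rw [← hsat, show e' + -(e' + b i - e + a i) + a i = e - b i by abel] at this
        exact this
    have h2 := (h.sat_add_right i (e - b i)).1
    rw [sub_add_cancel] at h2
    exact h2 (Or.inl (hET he)) h1

end QuadFamily

/-! ### The quotient by the two-torsion subgroup -/

lemma card_image_double (G : Type*) [AddCommGroup G] [Fintype G] :
    #((Finset.univ : Finset G).image fun x => x + x) * #{x : G | x + x = 0} = Fintype.card G := by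
  have h := Finset.card_eq_sum_card_image (fun x : G => x + x) Finset.univ
  rw [Finset.card_univ] at h
  rw [h, ← smul_eq_mul, ← Finset.sum_const]
  refine Finset.sum_congr rfl fun y hy => ?_
  obtain ⟨z, -, rfl⟩ := Finset.mem_image.1 hy
  refine Finset.card_bij (fun x _ => x + z) ?_ ?_ ?_
  · intro x hx
    simp only [Finset.mem_filter, Finset.mem_univ, true_and] at hx ⊢
    linear_combination (norm := abel) hx
  · intro x _ x' _ h
    exact add_right_cancel h
  · intro x hx
    simp only [Finset.mem_filter, Finset.mem_univ, true_and] at hx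
    refine ⟨x - z, ?_, by abel⟩
    simp only [Finset.mem_filter, Finset.mem_univ, true_and]
    linear_combination (norm := abel) hx

lemma IsSocleGenerator.add_self {g : G} (hg : IsSocleGenerator 2 g) : g + g = 0 := by
  rw [← two_nsmul, hg.nsmul_eq_zero]

lemma IsSocleGenerator.exists_add_self_eq {g : G} (hg : IsSocleGenerator 2 g) {x : G}
    (hx : x + x ≠ 0) : ∃ z, z + z = g := by
  obtain ⟨j, hj⟩ := hg.eq_nsmul x (by rwa [two_nsmul])
  exact ⟨j • x, by rw [hj, two_nsmul, nsmul_add]⟩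

/-- If the two-torsion subgroup has index two, then `{0, g}` is the image of multiplication by
two. -/
lemma add_self_eq_of_card {g : G} (hg : IsSocleGenerator 2 g) (hG : Fintype.card G = 32)
    (hK : #{x : G | x + x = 0} = 16) {x : G} (hx : x + x ≠ 0) : x + x = g := by
  have h1 := card_image_double G
  rw [hG, hK] at h1
  obtain ⟨z, hz⟩ := hg.exists_add_self_eq hx
  have h2 : ({0, g} : Finset G) = (Finset.univ : Finset G).image fun x => x + x := by
    apply Finset.eq_of_subset_of_card_le
    · intro y hy
      simp only [Finset.mem_insert, Finset.mem_singleton] at hy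
      rcases hy with rfl | rfl
      · exact Finset.mem_image.2 ⟨0, by simp⟩
      · exact Finset.mem_image.2 ⟨z, by simp [hz]⟩
    · rw [Finset.card_pair hg.ne_zero.symm]
      omega
  have h3 : x + x ∈ (Finset.univ : Finset G).image fun x => x + x := by simp
  rw [← h2] at h3
  simp only [Finset.mem_insert, Finset.mem_singleton] at h3
  exact h3.resolve_left hx

/-- If the two-torsion subgroup has index four, then the quotient by it is cyclic, generated by the
class of some `y`. -/
lemma exists_generator_of_card {g : G} (hg : IsSocleGenerator 2 g) (hG : Fintype.card G = 32)
    (hK : #{x : G | x + x = 0} = 8) :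
    ∃ y m : G, y + y = m ∧ m + m = g ∧
      ∀ x : G, x + x = 0 ∨ x + x = m ∨ x + x = g ∨ x + x = m + g := by
  have h1 := card_image_double G
  rw [hG, hK] at h1
  set M := (Finset.univ : Finset G).image fun x => x + x with hM
  have hM4 : #M = 4 := by omega
  have hmem : ∀ x : G, x + x ∈ M := fun x => by simp [hM]
  obtain ⟨m, hmM, hm⟩ : ∃ m ∈ M, m ∉ ({0, g} : Finset G) :=
    Finset.exists_mem_notMem_of_card_lt_card (by
      rw [hM4]; exact lt_of_le_of_lt Finset.card_le_two (by norm_num))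
  simp only [Finset.mem_insert, Finset.mem_singleton, not_or] at hm
  obtain ⟨y, -, hy⟩ := Finset.mem_image.1 hmM
  -- a multiple of an element of order two is zero or that element
  have hmul : ∀ z : G, z + z = 0 → ∀ j : ℕ, j • z = 0 ∨ j • z = z := by
    intro z hz j
    rcases Nat.even_or_odd' j with ⟨k, rfl | rfl⟩
    · left; rw [mul_nsmul, two_nsmul, hz, nsmul_zero]
    · right; rw [add_nsmul, mul_nsmul, two_nsmul, hz, nsmul_zero, zero_add, one_nsmul]
  have h2m : m + m ≠ 0 := by
    intro h0
    obtain ⟨j, hj⟩ := hg.eq_nsmul y (by rw [two_nsmul]; rw [hy]; exact hm.1)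
    rw [two_nsmul, hy] at hj
    rcases hmul m h0 j with h3 | h3
    · exact hg.ne_zero (hj.trans h3)
    · exact hm.2 (h3.symm.trans hj.symm)
  have h3m : m + m + m ≠ 0 := by
    intro h0
    apply h2m
    have h32 : 32 • m = 0 := by rw [← hG]; exact card_nsmul_eq_zero
    have : 32 • m = 10 • (m + m + m) + (m + m) := by module
    rw [h32, h0] at this
    simpa using this.symm
  have hMeq : ({0, m, m + m, m + m + m} : Finset G) = M := by
    apply Finset.eq_of_subset_of_card_le
    · intro x hx
      simp only [Finset.mem_insert, Finset.mem_singleton] at hx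
      rcases hx with rfl | rfl | rfl | rfl
      · simpa using hmem 0
      · exact hmM
      · exact hmem _
      · convert hmem (m + y) using 1
        linear_combination (norm := abel) -hy
    · rw [hM4, Finset.card_insert_of_notMem, Finset.card_insert_of_notMem, Finset.card_pair]
      · simpa using hm.1
      · simp only [Finset.mem_insert, Finset.mem_singleton, not_or]
        refine ⟨by simpa using hm.1, ?_⟩
        rw [add_assoc]
        simpa using h2m
      · simp only [Finset.mem_insert, Finset.mem_singleton, not_or]
        exact ⟨Ne.symm hm.1, h2m.symm, h3m.symm⟩
  have h4m : m + m + (m + m) = 0 := by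
    have h4 := hmem (m + m)
    rw [← hMeq] at h4
    simp only [Finset.mem_insert, Finset.mem_singleton] at h4
    rcases h4 with h4 | h4 | h4 | h4
    · exact h4
    · exact absurd (by linear_combination (norm := abel) h4) h3m
    · exact absurd (by linear_combination (norm := abel) h4) h2m
    · exact absurd (by linear_combination (norm := abel) h4) hm.1
  have hmg : m + m = g := by
    obtain ⟨j, hj⟩ := hg.eq_nsmul m (by rwa [two_nsmul])
    rw [two_nsmul] at hj
    rcases hmul _ h4m j with h3 | h3
    · exact absurd (hj.trans h3) hg.ne_zero
    · exact h3.symm.trans hj.symm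
  refine ⟨y, m, hy, hmg, fun x => ?_⟩
  have h5 := hmem x
  rw [← hMeq] at h5
  simp only [Finset.mem_insert, Finset.mem_singleton, hmg] at h5
  rwa [add_comm m g]

namespace QuadFamily
variable {T : Finset G} {a b : ι → G} {g : G}

/-! ### Two-torsion subgroup of index two -/

/-- The case where all quadruples have exponent four. -/
lemma commonPT_of_forall_ne_of_card (h : QuadFamily T a b) (hg : IsSocleGenerator 2 g)
    (hK : #{x : G | x + x = 0} = 16) {H : AddSubgroup G}
    (hΩ : ∀ i, Equidistributed 2 g H (quad (a i) (b i)))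
    (hb : ∀ i, b i + b i ≠ 0) : CommonPT fun i => quad (a i) (b i) := by
  have h2 := fun x hx => add_self_eq_of_card hg h.card_group hK (x := x) hx
  refine commonPT_of_equidistributed hg hΩ {0} ?_ ?_
  · intro i y
    by_cases hy : y + y = 0
    · exact ⟨0, by simp [mem_quad], 0, by simp, by simpa [two_nsmul] using hy⟩
    · refine ⟨b i, by simp [mem_quad], 0, by simp, ?_⟩
      have h3 := h2 y hy
      have h4 := h2 _ (hb i)
      linear_combination (norm := module) h3 - h4
  · intro i
    have := (hΩ i).card_subgroup Nat.prime_two hg.nsmul_eq_zero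
    simp only [two_nsmul, hK] at this
    rw [h.card_quad, h.card_group, Finset.card_singleton]
    omega

/-- The case where some quadruples have exponent two and others have exponent four. -/
lemma commonPT_of_card_eq_sixteen (h : QuadFamily T a b) (hg : IsSocleGenerator 2 g)
    (hK : #{x : G | x + x = 0} = 16) {i₀ i₁ : ι} (hi₀ : b i₀ + b i₀ = 0)
    (hi₁ : b i₁ + b i₁ ≠ 0) : CommonPT fun i => quad (a i) (b i) := by
  have h2 := fun x hx => add_self_eq_of_card hg h.card_group hK (x := x) hx
  have hgg := hg.add_self
  have hcount : ∀ t, #{f ∈ T | (f - t) + (f - t) = 0} = 4 := by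
    intro t
    have := h.card_coset hi₀ t
    omega
  have hout : ∀ t, ∃ x ∈ T, (x - t) + (x - t) ≠ 0 := by
    intro t
    obtain ⟨x, hx, hxn⟩ := Finset.exists_mem_notMem_of_card_lt_card
      (s := {f ∈ T | (f - t) + (f - t) = 0}) (t := T) (by rw [hcount, h.card_eq]; norm_num)
    refine ⟨x, hx, fun h0 => hxn (Finset.mem_filter.2 ⟨hx, h0⟩)⟩
  have hcover : ∀ t x : G, (x - t) + (x - t) = g →
      ∀ y : G, ∃ e ∈ ({t, x} : Finset G), (y - e) + (y - e) = 0 := by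
    intro t x hx y
    by_cases hy : (y - t) + (y - t) = 0
    · exact ⟨t, by simp, hy⟩
    · refine ⟨x, by simp, ?_⟩
      have := h2 _ hy
      linear_combination (norm := abel) this - hx
  have hEcard : ∀ t x : G, #({t, x} : Finset G) * #{x : G | x + x = 0} ≤ 32 := by
    intro t x
    have : #({t, x} : Finset G) ≤ 2 := Finset.card_le_two
    rw [hK]
    omega
  by_cases hA : ∃ i, b i + b i ≠ 0 ∧ a i ≠ g
  · obtain ⟨i, hi, hag⟩ := hA
    by_cases hgT : ∃ t ∈ T, t + g ∈ T
    · obtain ⟨t, ht, htg⟩ := hgT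
      obtain ⟨v, hv, hvT, hvS⟩ := exists_mem_coset_notMem (T := T) (t := t) (S := {t, t + g})
        (by rw [hcount]; exact lt_of_le_of_lt Finset.card_le_two (by norm_num))
      simp only [Finset.mem_singleton, Finset.mem_insert, not_or, add_eq_left,
        add_right_inj] at hvS
      obtain ⟨x, hxT, hx⟩ := hout t
      have hP1 : ∀ x ∈ adjoin ⊥ g hgg, x + x = 0 := add_self_of_mem_adjoin add_self_of_mem_bot
      have hsize : size (adjoin (adjoin ⊥ g hgg) v hv) = 4 := by
        rw [size_adjoin, size_adjoin, size_bot]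
        · simpa using hg.ne_zero
        · rw [mem_bot_adjoin]; tauto
      have hsat : ∀ i, b i + b i ≠ 0 → ∀ x ∈ adjoin (adjoin ⊥ g hgg) v hv,
          Sat T (a i) (t + x) := by
        intro i hi x hx
        rcases mem_bot_adjoin_adjoin.1 hx with rfl | rfl | rfl | rfl
        · exact Or.inl (by simpa using ht)
        · exact Or.inl htg
        · exact Or.inl hvT
        · rw [add_comm g, ← add_assoc, h.sat_add_socle hg hi]
          exact Or.inl hvT
      refine h.commonPT_of_socle_mem (P := adjoin (adjoin ⊥ g hgg) v hv) (E := {t, x})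
        (add_self_of_mem_adjoin hP1) (diffIn_adjoin hP1 (q := t) ?_ hv hvT) (by omega) (by omega)
        ?_ (hcover t x (h2 _ hx)) (hEcard t x) ?_
      · intro x hx
        rcases mem_bot_adjoin.1 hx with rfl | rfl
        · simpa using ht
        · exact htg
      · intro e he
        simp only [Finset.mem_insert, Finset.mem_singleton] at he
        rcases he with rfl | rfl
        · exact ht
        · exact hxT
      · intro i hi e he e' he' h0
        simp only [Finset.mem_insert, Finset.mem_singleton] at he he'
        rcases he with rfl | rfl
        · exact Or.inl (hsat i hi)
        · rcases he' with rfl | rfl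
          · exact Or.inr (hsat i hi)
          · exact absurd (by linear_combination (norm := abel) h0) hi
    · push Not at hgT
      exact h.commonPT_of_notMem hg hi hag hgT
  · push Not at hA
    -- From now on, `a i = g` for all quadruples of exponent four.
    have hgT : ∀ t ∈ T, t + g ∉ T := by
      intro t ht
      rw [← hA i₁ hi₁]
      exact (h.tiling i₁).add_notMem ht
    have hsatg : ∀ x, Sat T g (x + g) ↔ Sat T g x := by
      intro x
      have := (h.tiling i₁).sat_add_left (x := x)
      rwa [hA i₁ hi₁] at this
    have hsatb : ∀ i, b i + b i ≠ 0 → ∀ x, Sat T g (x + b i) ↔ ¬ Sat T g x := by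
      intro i hi x
      have := h.sat_add_right i x
      rwa [hA i hi] at this
    obtain ⟨t, ht⟩ : T.Nonempty := Finset.card_pos.1 (by rw [h.card_eq]; norm_num)
    obtain ⟨u, hu, huT, hu0⟩ := exists_mem_coset_notMem (T := T) (t := t) (S := {t})
      (by rw [hcount]; simp)
    obtain ⟨v, hv, hvT, hvS⟩ := exists_mem_coset_notMem (T := T) (t := t) (S := {t, t + u})
      (by rw [hcount]; exact lt_of_le_of_lt Finset.card_le_two (by norm_num))
    obtain ⟨c, hc, hcT, hcS⟩ := exists_mem_coset_notMem (T := T) (t := t)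
      (S := {t, t + u, t + v})
      (by rw [hcount]; exact lt_of_le_of_lt Finset.card_le_three (by norm_num))
    simp only [Finset.mem_singleton, Finset.mem_insert, not_or, add_eq_left,
      add_right_inj] at hu0 hvS hcS
    have hcoset : ∀ x, x + x = 0 → t + x ∈ T → x = 0 ∨ x = u ∨ x = v ∨ x = c := by
      intro x hx hxT
      have h3 : ({t, t + u, t + v, t + c} : Finset G) = {f ∈ T | (f - t) + (f - t) = 0} := by
        apply Finset.eq_of_subset_of_card_le
        · intro f hf
          simp only [Finset.mem_insert, Finset.mem_singleton] at hf
          rw [Finset.mem_filter]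
          rcases hf with rfl | rfl | rfl | rfl
          · exact ⟨ht, by simp⟩
          · exact ⟨huT, by simpa using hu⟩
          · exact ⟨hvT, by simpa using hv⟩
          · exact ⟨hcT, by simpa using hc⟩
        · rw [hcount, Finset.card_insert_of_notMem, Finset.card_insert_of_notMem,
            Finset.card_pair]
          · simpa using fun h => hcS.2.2 h.symm
          · simp only [Finset.mem_insert, Finset.mem_singleton, add_right_inj, not_or]
            exact ⟨fun h => hvS.2 h.symm, fun h => hcS.2.1 h.symm⟩
          · simp only [Finset.mem_insert, Finset.mem_singleton, left_eq_add, not_or]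
            exact ⟨hu0, hvS.1, hcS.1⟩
      have h4 : t + x ∈ ({t, t + u, t + v, t + c} : Finset G) := by
        rw [h3, Finset.mem_filter]
        exact ⟨hxT, by simpa using hx⟩
      simpa using h4
    have hug : u ≠ g := by rintro rfl; exact hgT t ht huT
    have hvg : v ≠ g := by rintro rfl; exact hgT t ht hvT
    have hcg : c ≠ g := by rintro rfl; exact hgT t ht hcT
    have huvg : u ≠ v + g := by
      rintro rfl
      rw [← add_assoc] at huT
      exact hgT _ hvT huT
    have hucg : u ≠ c + g := by
      rintro rfl
      rw [← add_assoc] at huT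
      exact hgT _ hcT huT
    have hvcg : v ≠ c + g := by
      rintro rfl
      rw [← add_assoc] at hvT
      exact hgT _ hcT hvT
    have hP1 : ∀ x ∈ adjoin ⊥ u hu, x + x = 0 := add_self_of_mem_adjoin add_self_of_mem_bot
    set P := adjoin (adjoin ⊥ u hu) v hv with hPdef
    have hmemP : ∀ x, x ∈ P ↔ x = 0 ∨ x = u ∨ x = v ∨ x = u + v := fun x => mem_bot_adjoin_adjoin
    have hsize : size P = 4 := by
      rw [hPdef, size_adjoin, size_adjoin, size_bot]
      · simpa using hu0
      · rw [mem_bot_adjoin]; tauto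
    -- It suffices to find a suitable second coset of `P`.
    suffices hx : ∃ x, (x - t) + (x - t) = g ∧ ∀ i, b i + b i ≠ 0 →
        ¬ (x + b i - t ∈ P ∨ x + b i - t + g ∈ P) by
      obtain ⟨x, hxt, hx⟩ := hx
      refine h.commonPT_of_diffIn (P := P) (E := {t, x})
        (add_self_of_mem_adjoin hP1) (diffIn_adjoin hP1 (q := t) ?_ hv hvT) (by omega) (by omega)
        (hcover t x hxt) (hEcard t x) ?_
      · intro x hx
        rcases mem_bot_adjoin.1 hx with rfl | rfl
        · simpa using ht
        · exact huT
      · intro i hi e he e' he' h0 hmem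
        rw [mem_adjoin, hA i hi] at hmem
        simp only [Finset.mem_insert, Finset.mem_singleton] at he he'
        have hbg := h2 _ hi
        rcases he with rfl | rfl <;> rcases he' with rfl | rfl
        · exact hi (by linear_combination (norm := abel) h0)
        · exact hx i hi hmem
        · have h5 : e + b i - e' + g = e' + b i - e := by
            linear_combination (norm := abel) hbg - h0 + hgg
          have h6 : e + b i - e' = e' + b i - e + g := by
            linear_combination (norm := abel) hbg - h0
          apply hx i hi
          rw [h5, h6]
          exact hmem.symm
        · exact hi (by linear_combination (norm := abel) h0)
    by_cases hcL : c ∈ P ∨ c + g ∈ P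
    · -- the coset `t + P` is contained in `T + {0, g}`, and any point of `T` in the other coset of
      -- the two-torsion subgroup will do
      obtain ⟨x, hxT, hx⟩ := hout t
      refine ⟨x, h2 _ hx, fun i hi hmem => ?_⟩
      have huv : Sat T g (t + (u + v)) := by
        rcases hcL with h5 | h5 <;> rw [hmemP] at h5
        · have : c = u + v := by tauto
          rw [← this]
          exact Or.inl hcT
        · have : u + v + g = c := by
            rcases h5 with h5 | h5 | h5 | h5 <;> grind
          refine Or.inr ?_
          rwa [add_assoc, this]
      have hsatP : ∀ y ∈ P, Sat T g (t + y) := by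
        intro y hy
        rcases (hmemP y).1 hy with rfl | rfl | rfl | rfl
        · exact Or.inl (by simpa using ht)
        · exact Or.inl huT
        · exact Or.inl hvT
        · exact huv
      have h6 : Sat T g (x + b i) := by
        rcases hmem with h5 | h5
        · simpa using hsatP _ h5
        · rw [← hsatg]
          have := hsatP _ h5
          rwa [show t + (x + b i - t + g) = x + b i + g by abel] at this
      exact (hsatb i hi x).1 h6 (Or.inl hxT)
    · -- `T + {0, g}` has no periods besides `0` and `g`
      push Not at hcL
      simp only [hmemP, not_or] at hcL
      have hb1 := h2 _ hi₁
      refine ⟨t + c + b i₁, by linear_combination (norm := abel) hc + hb1, fun i hi hmem => ?_⟩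
      have hbi := h2 _ hi
      set f := b i₁ + b i with hf
      have hff : f + f = 0 := by
        rw [hf]
        linear_combination (norm := abel) hb1 + hbi + hgg
      have hper : ∀ x, Sat T g (x + f) ↔ Sat T g x := by
        intro x
        rw [hf, ← add_assoc, hsatb i hi, hsatb i₁ hi₁, not_not]
      have hns : ∀ x y, (x = u ∧ y = v) ∨ (x = u ∧ y = c) → ¬ Sat T g (t + (x + y)) := by
        rintro x y hxy (h5 | h5)
        · have h6 := hcoset (x + y) (by grind) h5
          grind
        · rw [add_assoc] at h5
          have h6 := hcoset (x + y + g) (by grind) h5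
          grind
      have hnuv := hns u v (Or.inl ⟨rfl, rfl⟩)
      have hnuc := hns u c (Or.inr ⟨rfl, rfl⟩)
      have hfg : ∀ k, (∀ x, Sat T g (x + k) ↔ Sat T g x) → (k = 0 ∨ k = u ∨ k = v ∨ k = c) →
          k = 0 := by
        rintro k hk (rfl | rfl | rfl | rfl)
        · rfl
        · refine absurd ?_ hnuv
          rw [add_comm k, ← add_assoc, hk]
          exact Or.inl hvT
        · refine absurd ?_ hnuv
          rw [← add_assoc, hk]
          exact Or.inl huT
        · refine absurd ?_ hnuc
          rw [← add_assoc, hk]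
          exact Or.inl huT
      have hf0 : f = 0 ∨ f = g := by
        rcases (hper t).2 (Or.inl ht) with h5 | h5
        · exact Or.inl (hfg f hper (hcoset f hff h5))
        · right
          have h6 : f + g = 0 := hfg (f + g)
            (fun x => by rw [← add_assoc, hsatg, hper])
            (hcoset (f + g) (by linear_combination (norm := abel) hff + hgg)
              (by rwa [← add_assoc]))
          linear_combination (norm := abel) h6 - hgg
      rw [show t + c + b i₁ + b i - t = c + f by rw [hf]; abel, hmemP, hmemP] at hmem
      rcases hf0 with h5 | h5 <;> rw [h5] at hmem <;> grind

end QuadFamily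

namespace QuadFamily
variable {T : Finset G} {a b : ι → G} {g : G}

/-! ### Two-torsion subgroup of index four -/

/-- The case where all quadruples have exponent at least four, and all the `b i` have the same order
modulo the two-torsion subgroup. -/
lemma commonPT_of_same_parity (h : QuadFamily T a b) (hg : IsSocleGenerator 2 g)
    (hK : #{x : G | x + x = 0} = 8) {H : AddSubgroup G}
    (hΩ : ∀ i, Equidistributed 2 g H (quad (a i) (b i))) {y m : G} (hy : y + y = m)
    (hm : m + m = g) (hG : ∀ x : G, x + x = 0 ∨ x + x = m ∨ x + x = g ∨ x + x = m + g)
    (hb : (∀ i, b i + b i = g) ∨ ∀ i, b i + b i = m ∨ b i + b i = m + g) :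
    CommonPT fun i => quad (a i) (b i) := by
  have hgg := hg.add_self
  have hcard : ∀ (i : ι) (x : G),
      #(quad (a i) (b i)) * (#({0, x} : Finset G) * #{x : G | x ∈ H}) ≤ Fintype.card G := by
    intro i x
    have h1 := (hΩ i).card_subgroup Nat.prime_two hg.nsmul_eq_zero
    simp only [two_nsmul, hK] at h1
    have h2 : #{x : G | x ∈ H} = 4 := by omega
    have h3 : #({0, x} : Finset G) ≤ 2 := Finset.card_le_two
    rw [h.card_quad, h.card_group, h2]
    omega
  rcases hb with hb | hb
  · refine commonPT_of_equidistributed hg hΩ {0, y} (fun i x => ?_) fun i => hcard i y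
    have hbi := hb i
    rcases hG x with hx | hx | hx | hx
    · exact ⟨0, by simp [mem_quad], 0, by simp, by
        linear_combination (norm := module) hx⟩
    · exact ⟨0, by simp [mem_quad], y, by simp, by
        linear_combination (norm := module) hx - hy⟩
    · exact ⟨b i, by simp [mem_quad], 0, by simp, by
        linear_combination (norm := module) hx - hbi⟩
    · exact ⟨b i, by simp [mem_quad], y, by simp, by
        linear_combination (norm := module) hx - hbi - hy⟩
  · refine commonPT_of_equidistributed hg hΩ {0, m} (fun i x => ?_) fun i => hcard i m
    rcases hb i with hbi | hbi <;> rcases hG x with hx | hx | hx | hx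
    · exact ⟨0, by simp [mem_quad], 0, by simp, by
        linear_combination (norm := module) hx⟩
    · exact ⟨b i, by simp [mem_quad], 0, by simp, by
        linear_combination (norm := module) hx - hbi⟩
    · exact ⟨0, by simp [mem_quad], m, by simp, by
        linear_combination (norm := module) hx - hm⟩
    · exact ⟨b i, by simp [mem_quad], m, by simp, by
        linear_combination (norm := module) hx - hbi - hm⟩
    · exact ⟨0, by simp [mem_quad], 0, by simp, by
        linear_combination (norm := module) hx⟩
    · exact ⟨b i, by simp [mem_quad], m, by simp, by
        linear_combination (norm := module) hx - hbi - hm - hgg⟩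
    · exact ⟨0, by simp [mem_quad], m, by simp, by
        linear_combination (norm := module) hx - hm⟩
    · exact ⟨b i, by simp [mem_quad], 0, by simp, by
        linear_combination (norm := module) hx - hbi⟩

/-- If `b i` and `b i'` have different orders modulo the two-torsion subgroup, then `T` meets all
cosets of the latter. -/
lemma exists_mem_coset (h : QuadFamily T a b) (hg : IsSocleGenerator 2 g) {m : G}
    (hm : m + m = g) {i i' : ι} (hi : b i + b i = m ∨ b i + b i = m + g)
    (hi' : b i' + b i' = g) (y : G) : ∃ t ∈ T, (y - t) + (y - t) = 0 := by
  have hgg := hg.add_self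
  by_contra hcon
  push Not at hcon
  have hns : ∀ j, ∀ k, k + k = 0 → ¬ Sat T (a j) (y + k) := by
    have aux : ∀ k, k + k = 0 → y + k ∉ T := by
      intro k hk hkT
      exact hcon _ hkT (by linear_combination (norm := abel) -hk)
    rintro j k hk (h1 | h1)
    · exact aux k hk h1
    · have ha := h.add_self j
      exact aux (k + a j) (by linear_combination (norm := abel) hk + ha)
        (by rwa [← add_assoc])
  -- there is a point of `T` in the coset of `y + b i'`, which is also the coset of `y + 2 • b i`
  obtain ⟨t, ht, hty⟩ : ∃ t ∈ T, (t - y) + (t - y) = g := by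
    have ha := h.add_self i'
    rcases (h.sat_add_right i' y).2 (by simpa using hns i' 0 (by simp)) with h1 | h1
    · exact ⟨_, h1, by linear_combination (norm := abel) hi'⟩
    · exact ⟨_, h1, by linear_combination (norm := abel) hi' + ha⟩
  have h1 : Sat T (a i) (t - b i - b i + b i) := by
    rw [h.sat_add_right]
    have h2 : (t - b i - b i - y) + (t - b i - b i - y) = 0 := by
      rcases hi with hi | hi
      · linear_combination (norm := abel) hty - hi - hi - hm
      · linear_combination (norm := abel) hty - hi - hi - hm - hgg
    have := hns i _ h2
    rwa [show y + (t - b i - b i - y) = t - b i - b i by abel] at this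
  have h3 := (h.sat_add_right i (t - b i)).1
  rw [sub_add_cancel] at h3
  rw [sub_add_cancel] at h1
  exact h3 (Or.inl ht) h1

/-- The case where `T` meets all cosets of the two-torsion subgroup and some quadruple has exponent
larger than two. -/
lemma commonPT_of_card_eq_eight (h : QuadFamily T a b) (hg : IsSocleGenerator 2 g)
    (hK : #{x : G | x + x = 0} = 8) {y m : G} (hy : y + y = m)
    (hm : m + m = g) (hG : ∀ x : G, x + x = 0 ∨ x + x = m ∨ x + x = g ∨ x + x = m + g)
    (hmeet : ∀ y : G, ∃ t ∈ T, (y - t) + (y - t) = 0) {i₁ : ι} (hi₁ : b i₁ + b i₁ ≠ 0) :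
    CommonPT fun i => quad (a i) (b i) := by
  have hgg := hg.add_self
  by_cases hA : ∃ i, b i + b i ≠ 0 ∧ a i ≠ g
  · obtain ⟨i, hi, hag⟩ := hA
    by_cases hgT : ∃ t ∈ T, t + g ∈ T
    · obtain ⟨t, ht, htg⟩ := hgT
      obtain ⟨E, hET, hE, hEcard⟩ := exists_section h.card_group T hmeet
      have hsize : size (adjoin ⊥ g hgg) = 2 := by
        rw [size_adjoin, size_bot]
        simpa using hg.ne_zero
      refine h.commonPT_of_socle_mem (P := adjoin ⊥ g hgg)
        (add_self_of_mem_adjoin add_self_of_mem_bot)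
        (diffIn_adjoin add_self_of_mem_bot (q := t) ?_ hgg htg) (by omega) (by omega)
        hET hE hEcard ?_
      · intro x hx
        simpa [AddSubgroup.mem_bot.1 hx] using ht
      · intro i hi e he e' _ _
        left
        intro x hx
        rcases mem_bot_adjoin.1 hx with rfl | rfl
        · exact Or.inl (by simpa using hET he)
        · rw [h.sat_add_socle hg hi]
          exact Or.inl (hET he)
    · push Not at hgT
      exact h.commonPT_of_notMem hg hi hag hgT
  push Not at hA
  -- From now on, `a i = g` for all quadruples of exponent larger than two.
  by_cases htor : ∀ i, b i + b i ≠ 0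
  · exact h.commonPT_of_left_eq hg fun i => hA i (htor i)
  push Not at htor
  obtain ⟨i₀, hi₀⟩ := htor
  have hcount : ∀ t, #{f ∈ T | (f - t) + (f - t) = 0} = 2 := by
    intro t
    have := h.card_coset hi₀ t
    omega
  have hgT : ∀ t ∈ T, t + g ∉ T := by
    intro t ht
    rw [← hA i₁ hi₁]
    exact (h.tiling i₁).add_notMem ht
  have hsatg : ∀ x, Sat T g (x + g) ↔ Sat T g x := by
    intro x
    have := (h.tiling i₁).sat_add_left (x := x)
    rwa [hA i₁ hi₁] at this
  have hsatb : ∀ i, b i + b i ≠ 0 → ∀ x, Sat T g (x + b i) ↔ ¬ Sat T g x := by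
    intro i hi x
    have := h.sat_add_right i x
    rwa [hA i hi] at this
  have hmate : ∀ t ∈ T, ∃ d, d + d = 0 ∧ t + d ∈ T ∧ d ≠ 0 := by
    intro t ht
    obtain ⟨d, hd, hdT, hd0⟩ := exists_mem_coset_notMem (T := T) (t := t) (S := {t})
      (by rw [hcount]; simp)
    exact ⟨d, hd, hdT, by simpa using hd0⟩
  obtain ⟨t₀, ht₀⟩ : T.Nonempty := Finset.card_pos.1 (by rw [h.card_eq]; norm_num)
  obtain ⟨d₀, hd₀, hd₀T, hd₀0⟩ := hmate t₀ ht₀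
  have hd₀g : d₀ ≠ g := by rintro rfl; exact hgT _ ht₀ hd₀T
  set P := adjoin ⊥ d₀ hd₀ with hPdef
  have hP : ∀ x ∈ P, x + x = 0 := add_self_of_mem_adjoin add_self_of_mem_bot
  have hsize : size P = 2 := by
    rw [hPdef, size_adjoin, size_bot]
    simpa using hd₀0
  set L := adjoin P g hgg with hLdef
  have hmemL : ∀ x, x ∈ L ↔ x = 0 ∨ x = d₀ ∨ x = g ∨ x = d₀ + g := fun x => mem_bot_adjoin_adjoin
  have hgP : g ∉ P := by
    rw [hPdef, mem_bot_adjoin, not_or]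
    exact ⟨hg.ne_zero, hd₀g.symm⟩
  have hindex : ∀ k k', k + k = 0 → k' + k' = 0 → k ∉ L → k' ∉ L → k - k' ∈ L :=
    fun k k' hk hk' => sub_mem_adjoin hP (by omega) hgg hgP hk hk'
  -- An element of `T` is good if its mate differs from it by an element of `L`.
  set Good : G → Prop := fun t => t ∈ T ∧ ∃ d ∈ L, d ≠ 0 ∧ t + d ∈ T with hGood
  have hgood₀ : Good t₀ := ⟨ht₀, d₀, by rw [hmemL]; simp, hd₀0, hd₀T⟩
  have hsatL : ∀ t, Good t → ∀ x ∈ L, Sat T g (t + x) := by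
    rintro t ⟨ht, d, hdL, hd0, hdT⟩ x hx
    have hdg : d ≠ g := by rintro rfl; exact hgT _ ht hdT
    have h1 : Sat T g (t + d₀) := by
      rcases (hmemL d).1 hdL with h2 | h2 | h2 | h2
      · exact absurd h2 hd0
      · rw [← h2]; exact Or.inl hdT
      · exact absurd h2 hdg
      · right; rwa [add_assoc, ← h2]
    rcases (hmemL x).1 hx with rfl | rfl | rfl | rfl
    · exact Or.inl (by simpa using ht)
    · exact h1
    · rw [hsatg]; exact Or.inl ht
    · rw [← add_assoc, hsatg]; exact h1
  have hflip : ∀ i, b i + b i ≠ 0 → ∀ t t', Good t → t' ∈ T → t' - b i - t ∉ L := by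
    intro i hi t t' ht ht' hL
    have h1 := hsatL t ht _ hL
    rw [add_sub_cancel] at h1
    have h2 := (hsatb i hi (t' - b i)).1
    rw [sub_add_cancel] at h2
    exact h2 (Or.inl ht') h1
  have hflip' : ∀ i, b i + b i ≠ 0 → ∀ t t', Good t → t' ∈ T → t' + b i - t ∉ L := by
    intro i hi t t' ht ht' hL
    have h1 := hsatL t ht _ hL
    rw [add_sub_cancel] at h1
    exact (hsatb i hi t').1 h1 (Or.inl ht')
  have hstep : ∀ i, b i + b i ≠ 0 → ∀ t t', Good t → t' ∈ T →
      (t' - b i - t) + (t' - b i - t) = 0 → Good t' := by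
    intro i hi t t' ht ht' htt
    obtain ⟨d, hd, hdT, hd0⟩ := hmate t' ht'
    refine ⟨ht', d, ?_, hd0, hdT⟩
    have h1 := hindex (t' + d - b i - t) (t' - b i - t)
      (by linear_combination (norm := abel) htt + hd) htt (hflip i hi t _ ht hdT)
      (hflip i hi t t' ht ht')
    convert h1 using 1
    abel
  have hdiff : DiffIn P T := diffIn_adjoin add_self_of_mem_bot (q := t₀)
    (fun x hx => by simpa [AddSubgroup.mem_bot.1 hx] using ht₀) hd₀ hd₀T
  have hmemLa : ∀ i, b i + b i ≠ 0 → ∀ x, x ∈ adjoin P (a i) (h.add_self i) ↔ x ∈ L := by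
    intro i hi x
    change (x ∈ P ∨ x + a i ∈ P) ↔ (x ∈ P ∨ x + g ∈ P)
    rw [hA i hi]
  by_cases hall : ∀ t ∈ T, Good t
  · obtain ⟨E, hET, hE, hEcard⟩ := exists_section h.card_group T hmeet
    refine h.commonPT_of_diffIn hP hdiff (by omega) (by omega) hE hEcard ?_
    intro i hi e he e' he' _
    rw [hmemLa i hi]
    exact hflip' i hi e e' (hall e (hET he)) (hET he')
  push Not at hall
  obtain ⟨t₃, ht₃, hbad⟩ := hall
  -- If some `b i` generated `G` modulo the two-torsion subgroup, all elements of `T` would be good.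
  have heven : ∀ i, b i + b i ≠ 0 → b i + b i = g := by
    intro i hi
    by_contra hne
    have hreach : ∀ j : ℕ, ∀ t' ∈ T,
        (t' - t₀) + (t' - t₀) = (j + 1) • (b i + b i) → Good t' := by
      intro j
      induction j with
      | zero =>
        intro t' ht' he
        exact hstep i hi t₀ t' hgood₀ ht' (by linear_combination (norm := module) he)
      | succ j ih =>
        intro t' ht' he
        obtain ⟨t, ht, hte⟩ := hmeet (t' - b i)
        have h1 : Good t := ih t ht (by linear_combination (norm := module) he - hte)
        exact hstep i hi t t' h1 ht' (by linear_combination (norm := module) hte)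
    apply hbad
    rcases hG (b i) with hb | hb | hb | hb
    · exact absurd hb hi
    · rcases hG (t₃ - t₀) with h3 | h3 | h3 | h3
      · exact hreach 3 t₃ ht₃ (by
          rw [hb]; linear_combination (norm := module) h3 - hm - hm - hgg)
      · exact hreach 0 t₃ ht₃ (by rw [hb]; linear_combination (norm := module) h3)
      · exact hreach 1 t₃ ht₃ (by rw [hb]; linear_combination (norm := module) h3 - hm)
      · exact hreach 2 t₃ ht₃ (by rw [hb]; linear_combination (norm := module) h3 - hm)
    · exact absurd hb hne
    · rcases hG (t₃ - t₀) with h3 | h3 | h3 | h3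
      · exact hreach 3 t₃ ht₃ (by
          rw [hb]; linear_combination (norm := module) h3 - hm - hm - hgg - hgg - hgg)
      · exact hreach 2 t₃ ht₃ (by
          rw [hb]; linear_combination (norm := module) h3 - hm - hgg - hgg)
      · exact hreach 1 t₃ ht₃ (by rw [hb]; linear_combination (norm := module) h3 - hm - hgg)
      · exact hreach 0 t₃ ht₃ (by rw [hb]; linear_combination (norm := module) h3)
  obtain ⟨t₂, ht₂, ht₂m⟩ := hmeet (t₀ + m)
  have hgood₂ : Good t₂ := hstep i₁ hi₁ t₀ t₂ hgood₀ ht₂ (by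
    have := heven i₁ hi₁
    linear_combination (norm := abel) hm - this - ht₂m)
  have hm0 : m ≠ 0 := by
    rintro rfl
    apply hg.ne_zero
    simpa using hm.symm
  have hmg : m ≠ g := by
    rintro rfl
    exact hg.ne_zero (hm.symm.trans hgg)
  refine h.commonPT_of_diffIn hP hdiff (E := {t₀, t₂, t₀ + y, t₂ + y}) (by omega) (by omega) ?_ ?_
    ?_
  · intro z
    rcases hG (z - t₀) with h3 | h3 | h3 | h3
    · exact ⟨t₀, by simp, h3⟩
    · exact ⟨t₀ + y, by simp, by linear_combination (norm := abel) h3 - hy⟩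
    · exact ⟨t₂, by simp, by linear_combination (norm := abel) h3 + ht₂m - hm⟩
    · exact ⟨t₂ + y, by simp, by linear_combination (norm := abel) h3 + ht₂m - hm - hy⟩
  · rw [hK]
    have : #({t₀, t₂, t₀ + y, t₂ + y} : Finset G) ≤ 4 := Finset.card_le_four
    omega
  · intro i hi e he e' he' h0
    rw [hmemLa i hi]
    have hbi := heven i hi
    have h02 := hflip' i hi t₀ t₂ hgood₀ ht₂
    have h20 := hflip' i hi t₂ t₀ hgood₂ ht₀
    simp only [Finset.mem_insert, Finset.mem_singleton] at he he'
    rcases he with rfl | rfl | rfl | rfl <;> rcases he' with rfl | rfl | rfl | rfl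
    · exact absurd (by linear_combination (norm := abel) h0) hi
    · exact h02
    · exact absurd (by linear_combination (norm := abel) h0 - hy - hbi - hgg) hmg
    · exact absurd (by linear_combination (norm := abel) h0 - hy - hbi + ht₂m - hm - hgg) hm0
    · exact h20
    · exact absurd (by linear_combination (norm := abel) h0) hi
    · exact absurd (by linear_combination (norm := abel) h0 - hy - hbi - ht₂m + hm) hm0
    · exact absurd (by linear_combination (norm := abel) h0 - hy - hbi - hgg) hmg
    · exact absurd (by linear_combination (norm := abel) -h0 - hy + hbi) hmg
    · exact absurd (by linear_combination (norm := abel) -h0 - hy + hbi - ht₂m + hm + hgg) hm0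
    · exact absurd (by linear_combination (norm := abel) h0) hi
    · exact fun hc => h02 (by convert hc using 1; abel)
    · exact absurd (by linear_combination (norm := abel) -h0 - hy + hbi + ht₂m - hm) hm0
    · exact absurd (by linear_combination (norm := abel) -h0 - hy + hbi) hmg
    · exact fun hc => h20 (by convert hc using 1; abel)
    · exact absurd (by linear_combination (norm := abel) h0) hi

end QuadFamily

/-! ### The periodicity property for families in `p`-groups -/

lemma Equidistributed.translate {p : ℕ} {g : G} {H : AddSubgroup G} {F : Finset G} {x : G}
    (h : Equidistributed p g H (F.image (x + ·))) : Equidistributed p g H F where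
  nsmul_eq_zero := h.nsmul_eq_zero
  notMem := h.notMem
  exists_sub_mem := h.exists_sub_mem
  card_eq y := by
    have key : ∀ z, #{f ∈ F.image (x + ·) | f - (x + z) ∈ H} = #{f ∈ F | f - z ∈ H} := by
      intro z
      rw [Finset.filter_image, Finset.card_image_of_injective _ (add_right_injective x)]
      congr 1
      ext f
      rw [Finset.mem_filter, Finset.mem_filter, add_sub_add_left_eq_sub]
    rw [← key, ← key, h.card_eq, add_assoc]

lemma Tiles.translate {Ω T : Finset G} {x : G} (h : Tiles (Ω.image (x + ·)) T) : Tiles Ω T := by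
  refine Tiles.of_exists (fun y => ?_) ?_
  · obtain ⟨w, hw, t, ht, he⟩ := h.exists_add_eq (x + y)
    obtain ⟨v, hv, rfl⟩ := Finset.mem_image.1 hw
    exact ⟨v, hv, t, ht, by linear_combination (norm := abel) he⟩
  · rw [← h.card_mul, Finset.card_image_of_injective _ (add_right_injective x)]

lemma Tiles.image_add {Ω T : Finset G} (h : Tiles Ω T) (x : G) : Tiles (Ω.image (x + ·)) T := by
  refine Tiles.of_exists (fun y => ?_) ?_
  · obtain ⟨w, hw, t, ht, he⟩ := h.exists_add_eq (y - x)
    exact ⟨x + w, Finset.mem_image_of_mem _ hw, t, ht, by linear_combination (norm := abel) he⟩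
  · rw [← h.card_mul, Finset.card_image_of_injective _ (add_right_injective x)]

lemma CommonPT.image_add {Ω : ι → Finset G} (h : CommonPT Ω) (x : ι → G) :
    CommonPT fun i => (Ω i).image (x i + ·) := by
  rcases h with ⟨g, hg, h⟩ | ⟨T, hT, h⟩
  · refine Or.inl ⟨g, hg, fun i w hw => ?_⟩
    obtain ⟨v, hv, rfl⟩ := Finset.mem_image.1 hw
    exact Finset.mem_image.2 ⟨v + g, h i v hv, by abel⟩
  · exact Or.inr ⟨T, hT, fun i => (h i).image_add (x i)⟩

/-- Families of quadruples in a group of order `32` whose two-torsion subgroup has order at least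
eight. -/
lemma QuadFamily.commonPT {T : Finset G} {a b : ι → G} (h : QuadFamily T a b) {g : G}
    (hg : IsSocleGenerator 2 g) {H : AddSubgroup G}
    (hΩ : ∀ i, Equidistributed 2 g H (quad (a i) (b i)))
    (hK : 4 < #{x : G | x + x = 0}) : CommonPT fun i => quad (a i) (b i) := by
  have hdvd := Dvd.intro_left _ (card_image_double G)
  rw [h.card_group] at hdvd
  have hle := Nat.le_of_dvd (by norm_num) hdvd
  have hK' : #{x : G | x + x = 0} = 8 ∨ #{x : G | x + x = 0} = 16 ∨
      #{x : G | x + x = 0} = 32 := by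
    generalize #{x : G | x + x = 0} = n at *
    interval_cases n <;> omega
  by_cases htor : ∀ i, b i + b i = 0
  · rcases isEmpty_or_nonempty ι with _ | _
    · exact Or.inl ⟨g, hg.ne_zero, fun i => isEmptyElim i⟩
    · exact h.commonPT_of_torsion htor hK'
  push Not at htor
  obtain ⟨i₁, hi₁⟩ := htor
  rcases hK' with hK | hK | hK
  · obtain ⟨y, m, hy, hm, hG⟩ := exists_generator_of_card hg h.card_group hK
    by_cases htor : ∀ i, b i + b i ≠ 0
    · by_cases h1 : ∀ i, b i + b i = g
      · exact h.commonPT_of_same_parity hg hK hΩ hy hm hG (Or.inl h1)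
      by_cases h2 : ∀ i, b i + b i ≠ g
      · refine h.commonPT_of_same_parity hg hK hΩ hy hm hG (Or.inr fun i => ?_)
        have := hG (b i)
        have := h2 i
        have := htor i
        tauto
      push Not at h1 h2
      obtain ⟨i, hi⟩ := h1
      obtain ⟨i', hi'⟩ := h2
      refine h.commonPT_of_card_eq_eight hg hK hy hm hG
        (fun z => h.exists_mem_coset hg hm (i := i) ?_ hi' z) hi₁
      have := hG (b i)
      have := htor i
      tauto
    · push Not at htor
      obtain ⟨i₀, hi₀⟩ := htor
      refine h.commonPT_of_card_eq_eight hg hK hy hm hG (fun z => ?_) hi₁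
      have hcount := h.card_coset hi₀ z
      obtain ⟨t, ht⟩ := Finset.card_pos.1 (by omega : 0 < #{t ∈ T | (t - z) + (t - z) = 0})
      rw [Finset.mem_filter] at ht
      exact ⟨t, ht.1, by linear_combination (norm := abel) -ht.2⟩
  · by_cases htor : ∀ i, b i + b i ≠ 0
    · exact h.commonPT_of_forall_ne_of_card hg hK hΩ htor
    · push Not at htor
      obtain ⟨i₀, hi₀⟩ := htor
      exact h.commonPT_of_card_eq_sixteen hg hK hi₀ hi₁
  · have h3 : ({x : G | x + x = 0} : Finset G) = Finset.univ :=
      Finset.eq_univ_of_card _ (by rw [hK, h.card_group])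
    have := Finset.mem_univ (b i₁)
    rw [← h3] at this
    exact absurd (by simpa using this) hi₁

/-- The case of sets of four points with a complement of eight points. If the characters with
vanishing sum over some `Ω i` are trivial on some `k ≠ 0`, then `k` is a period of `T`; otherwise
all `Ω i` are translates of quadruples. -/
lemma commonPT_of_card_eq_thirtyTwo {g : G} (hg : IsSocleGenerator 2 g) {Ω : ι → Finset G}
    {T : Finset G} (hT : ∀ i, Tiles (Ω i) T) {H H' : AddSubgroup G}
    (hΩ : ∀ i, Equidistributed 2 g H (Ω i)) (hTH : Equidistributed 2 g H' T)
    (hG : Fintype.card G = 32) (hcard : #T = 8) : CommonPT Ω := by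
  have hcard' : ∀ i, #(Ω i) = 4 := by
    intro i
    have := (hT i).card_mul
    rw [hG, hcard] at this
    omega
  by_cases hK : #{x : G | x + x = 0} ≤ 4
  · exact commonPT_of_card_torsion_le Nat.prime_two hg hT hΩ hTH (by simpa [two_nsmul] using hK)
  by_cases hk : ∃ i, ∃ k : G, k ≠ 0 ∧ ∀ χ : AddChar G ℂ, ∑ f ∈ Ω i, χ f = 0 → χ k = 1
  · obtain ⟨i, k, hk0, hk⟩ := hk
    refine Or.inr ⟨T, ⟨k, hk0, fun t ht => add_mem_of_char_sum (fun χ hχ => ?_) ht⟩, hT⟩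
    have hne : χ ≠ 0 := by rintro rfl; simp at hχ
    exact (mul_eq_zero.1 ((hT i).char_sum_mul hne)).resolve_left fun h1 => hχ (hk χ h1)
  · push Not at hk
    have hquad : ∀ i, ∃ x a b, a ≠ 0 ∧ a + a = 0 ∧ Ω i = (quad a b).image (x + ·) := by
      intro i
      rcases four_points hg.nsmul_eq_zero (hΩ i) (hcard' i) with h | ⟨k, hk0, h⟩
      · exact h
      · obtain ⟨χ, h1, h2⟩ := hk i k hk0
        exact absurd (h χ h1) h2
    choose x a b ha0 ha hΩeq using hquad
    obtain rfl : Ω = fun i => (quad (a i) (b i)).image (x i + ·) := funext hΩeq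
    have hfam : QuadFamily T a b := ⟨hcard, hG, fun i => ⟨ha0 i, ha i, (hT i).translate⟩⟩
    exact (hfam.commonPT hg (fun i => (hΩ i).translate) (by omega)).image_add x

/-- The groups in question: nontrivial `p`-groups with a socle generator which have order at most
`p ^ 3`, or at most `p ^ 2` elements of order at most `p`, or order at most `32`. -/
theorem commonPT_of_tiles {p N : ℕ} (hp : p.Prime) (hG : Fintype.card G = p ^ (N + 1)) {g : G}
    (hg : IsSocleGenerator p g)
    (hcase : N + 1 ≤ 3 ∨ #{x : G | p • x = 0} ≤ p ^ 2 ∨ (p = 2 ∧ N + 1 ≤ 5))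
    {Ω : ι → Finset G} {T : Finset G} (hT : ∀ i, Tiles (Ω i) T) : CommonPT Ω := by
  rcases isEmpty_or_nonempty ι with _ | ⟨⟨i₀⟩⟩
  · exact Or.inl ⟨g, hg.ne_zero, fun i => isEmptyElim i⟩
  rcases commonPT_or_equidistributed hp hG hg hT with h | ⟨⟨H, hΩ⟩, H', hTH⟩
  · exact h
  by_cases hK : #{x : G | p • x = 0} ≤ p ^ 2
  · exact commonPT_of_card_torsion_le hp hg hT hΩ hTH hK
  have hmul := fun i => (hT i).card_mul
  obtain ⟨e, he, hTe⟩ := (Nat.dvd_prime_pow hp).1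
    (hG ▸ Dvd.intro_left _ (hmul i₀) : #T ∣ p ^ (N + 1))
  have hΩe : ∀ i, #(Ω i) = p ^ (N + 1 - e) := by
    intro i
    have h1 := hmul i
    rw [hG, hTe] at h1
    apply Nat.eq_of_mul_eq_mul_right (pow_pos hp.pos e)
    rw [h1, ← pow_add]
    congr 1
    omega
  -- equidistributed sets have at least `p` elements
  have hle : ∀ F : Finset G, F.Nonempty → ∀ H, Equidistributed p g H F → p ≤ #F := by
    rintro F ⟨x, hx⟩ H hF
    exact (hF.le_card_coset hp hg.nsmul_eq_zero hx).trans
      (Finset.card_le_card (Finset.filter_subset _ _))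
  have he0 : e ≠ 0 := by
    rintro rfl
    have := hle T (hT i₀).nonempty_right H' hTH
    rw [hTe, pow_zero] at this
    exact absurd this (not_le.2 hp.one_lt)
  have heN : N + 1 - e ≠ 0 := by
    intro h0
    have := hle (Ω i₀) (hT i₀).nonempty_left H (hΩ i₀)
    rw [hΩe, h0, pow_zero] at this
    exact absurd this (not_le.2 hp.one_lt)
  by_cases he1 : e = 1
  · exact commonPT_of_tiles_card_eq_prime hp hg hT hTH (by rw [hTe, he1, pow_one])
  by_cases heN1 : N + 1 - e = 1
  · exact commonPT_of_card_eq_prime hp hg hΩ fun i => by rw [hΩe, heN1, pow_one]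
  obtain ⟨rfl, hN⟩ : p = 2 ∧ N + 1 ≤ 5 := by
    rcases hcase with h | h | h
    · omega
    · exact absurd h hK
    · exact h
  by_cases he2 : e = 2
  · exact commonPT_of_tiles_card_eq_four hg hT hTH (by rw [hTe, he2]; norm_num)
  · have he3 : e = 3 := by omega
    have hN4 : N + 1 = 5 := by omega
    exact commonPT_of_card_eq_thirtyTwo hg hT hΩ hTH (by rw [hG, hN4]; norm_num)
      (by rw [hTe, he3]; norm_num)

end CommonComplement

/-! ### Splitting off the square-free part -/

section Reduction
variable {A : Type*} [AddCommGroup A] [Fintype A]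

/-- If multiplication by `k` is not injective on `A` and `k` is coprime to the size of `Ω`, then the
preimage of `T` under multiplication by `k` is a periodic tiling complement of `Ω`. -/
lemma Tiles.exists_hasPeriod {Ω T : Finset A} (h : Tiles Ω T) {k : ℕ} (hk : k ≠ 0)
    (hkΩ : k.Coprime #Ω) {z : A} (hz : z ≠ 0) (hkz : k • z = 0) :
    ∃ T' : Finset A, HasPeriod T' ∧ Tiles Ω T' := by
  have h1 : Tiles (Ω.image (k • ·)) T := (h.symm.image_nsmul hk hkΩ).symm
  have hinj : ∀ w ∈ Ω, ∀ w' ∈ Ω, k • w = k • w' → w = w' := by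
    have hcard : #(Ω.image (k • ·)) = #Ω := by
      have h2 := h1.card_mul
      rw [← h.card_mul] at h2
      exact Nat.eq_of_mul_eq_mul_right (Finset.card_pos.2 h.nonempty_right) h2
    exact fun w hw w' hw' he => Finset.card_image_iff.1 hcard hw hw' he
  refine ⟨Finset.univ.filter (k • · ∈ T), ⟨z, hz, fun x hx => ?_⟩, ⟨?_, fun y => ?_⟩⟩
  · simpa [hkz] using hx
  · rintro ⟨⟨w, hw⟩, ⟨x, hx⟩⟩ ⟨⟨w', hw'⟩, ⟨x', hx'⟩⟩ he
    simp only [Finset.coe_filter, Finset.mem_univ, true_and, Set.mem_ofPred_eq] at hx hx'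
    change w + x = w' + x' at he
    have h2 := h1.eq_and_eq (Finset.mem_image_of_mem _ hw) (Finset.mem_image_of_mem _ hw') hx hx'
      (by rw [← nsmul_add, he, nsmul_add])
    obtain rfl := hinj w hw w' hw' h2.1
    obtain rfl := add_left_cancel he
    rfl
  · obtain ⟨v, hv, t, ht, he⟩ := h1.exists_add_eq (k • y)
    obtain ⟨w, hw, rfl⟩ := Finset.mem_image.1 hv
    refine ⟨(⟨w, hw⟩, ⟨y - w, ?_⟩), by simp⟩
    simp only [Finset.coe_filter, Finset.mem_univ, true_and, Set.mem_ofPred_eq]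
    convert ht using 1
    rw [nsmul_sub, ← he]
    simp

/-- If a prime divides the order of the group just once and it divides the size of `T`, then `T` can
be replaced by a periodic set. -/
lemma Tiles.exists_hasPeriod_of_prime_dvd {Ω T : Finset A} (h : Tiles Ω T) {q B : ℕ}
    (hq : q.Prime) (hA : Fintype.card A = q * B) (hqB : ¬ q ∣ B) (hqT : q ∣ #T) :
    ∃ T' : Finset A, HasPeriod T' ∧ Tiles Ω T' := by
  have := Fact.mk hq
  obtain ⟨z, hz⟩ := exists_prime_addOrderOf_dvd_card q (hA ▸ Dvd.intro _ rfl : q ∣ Fintype.card A)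
  have hqz : q • z = 0 := by rw [← hz]; exact addOrderOf_nsmul_eq_zero z
  have hz0 : z ≠ 0 := by
    rintro rfl
    rw [addOrderOf_zero] at hz
    exact hq.one_lt.ne hz
  refine h.exists_hasPeriod hq.ne_zero ((Nat.Prime.coprime_iff_not_dvd hq).2 fun hqΩ => hqB ?_) hz0
    hqz
  have h1 := mul_dvd_mul hqΩ hqT
  rw [h.card_mul, hA] at h1
  exact Nat.dvd_of_mul_dvd_mul_left hq.pos h1

lemma HasPeriod.isPeriodicSet {F : Finset A} (h : HasPeriod F) (hF : F.Nonempty) :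
    IsPeriodicSet (F : Set A) := by
  obtain ⟨g, hg, h⟩ := h
  refine ⟨by simpa using hF, g, hg, ?_⟩
  have h1 : F.image (· + g) = F := by
    apply Finset.eq_of_subset_of_card_le
    · intro x hx
      obtain ⟨f, hf, rfl⟩ := Finset.mem_image.1 hx
      exact h f hf
    · rw [Finset.card_image_of_injective _ (add_left_injective g)]
  rw [← Finset.coe_image, h1]

lemma hasPTProperty_of_tiles
    (h : ∀ Ω T : Finset A, Tiles Ω T →
      HasPeriod Ω ∨ ∃ T' : Finset A, HasPeriod T' ∧ Tiles Ω T') : HasPTProperty A := by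
  intro Ω T hΩT
  have hcoe : Tiles Ω.toFinite.toFinset T.toFinite.toFinset := by
    simpa [Tiles] using hΩT
  rcases h _ _ hcoe with h1 | ⟨T', h1, h2⟩
  · left
    simpa using h1.isPeriodicSet hcoe.nonempty_left
  · right
    exact ⟨T', h1.isPeriodicSet h2.nonempty_right, by simpa [Tiles] using h2⟩

end Reduction

section Slices
variable {G Z : Type*} [AddCommGroup G] [Fintype G] [AddCommGroup Z] [Fintype Z]

/-- The slice over `z` of a subset of `G × Z`. -/
noncomputable def slice (Ω : Finset (G × Z)) (z : Z) : Finset G := {x | (x, z) ∈ Ω}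

lemma mem_slice {Ω : Finset (G × Z)} {z : Z} {x : G} : x ∈ slice Ω z ↔ (x, z) ∈ Ω := by
  simp [slice]

/-- A subset of `G × 0` complements a subset of `G × Z` if and only if it complements all slices of
the latter. -/
lemma tiles_prod_zero_iff [DecidableEq (G × Z)] {Ω : Finset (G × Z)} {T : Finset G} :
    Tiles Ω (T.image fun t => (t, (0 : Z))) ↔ ∀ z, Tiles (slice Ω z) T := by
  constructor
  · intro h z
    refine ⟨?_, fun y => ?_⟩
    · rintro ⟨⟨w, hw⟩, ⟨t, ht⟩⟩ ⟨⟨w', hw'⟩, ⟨t', ht'⟩⟩ he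
      have := h.eq_and_eq (mem_slice.1 hw) (mem_slice.1 hw') (Finset.mem_image_of_mem _ ht)
        (Finset.mem_image_of_mem _ ht') (by simpa using he)
      simp only [Prod.mk.injEq, and_true] at this
      simp [this]
    · obtain ⟨⟨w, z'⟩, hw, u, hu, he⟩ := h.exists_add_eq (y, z)
      obtain ⟨t, ht, rfl⟩ := Finset.mem_image.1 hu
      simp only [Prod.mk_add_mk, add_zero, Prod.mk.injEq] at he
      obtain ⟨he, rfl⟩ := he
      exact ⟨(⟨w, mem_slice.2 hw⟩, ⟨t, ht⟩), he⟩
  · intro h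
    refine ⟨?_, fun y => ?_⟩
    · rintro ⟨⟨⟨w, z⟩, hw⟩, ⟨u, hu⟩⟩ ⟨⟨⟨w', z'⟩, hw'⟩, ⟨u', hu'⟩⟩ he
      obtain ⟨t, ht, rfl⟩ := Finset.mem_image.1 hu
      obtain ⟨t', ht', rfl⟩ := Finset.mem_image.1 hu'
      simp only [Prod.mk_add_mk, add_zero, Prod.mk.injEq] at he
      obtain ⟨he, rfl⟩ := he
      have := (h z).eq_and_eq (mem_slice.2 hw) (mem_slice.2 hw') ht ht' he
      simp [this]
    · obtain ⟨w, hw, t, ht, he⟩ := (h y.2).exists_add_eq y.1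
      refine ⟨(⟨(w, y.2), mem_slice.1 hw⟩, ⟨(t, 0), Finset.mem_image_of_mem _ ht⟩), ?_⟩
      ext <;> simp [he]

/-- The reduction of the periodicity property of `G × ZMod m` to families of subsets of `G`. -/
lemma hasPTProperty_prod {m : ℕ} [NeZero m] (hm : Squarefree m)
    (hcop : (Fintype.card G).Coprime m) (hnt : Nontrivial (G × ZMod m))
    (hG : Nontrivial G → ∀ (Ω : ZMod m → Finset G) (T : Finset G), (∀ z, Tiles (Ω z) T) →
      CommonPT Ω) : HasPTProperty (G × ZMod m) := by
  refine hasPTProperty_of_tiles fun Ω T h => ?_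
  have hcard : Fintype.card (G × ZMod m) = Fintype.card G * m := by
    rw [Fintype.card_prod, ZMod.card]
  by_cases hq : ∃ q, q.Prime ∧ q ∣ m ∧ q ∣ #T
  · obtain ⟨q, hq, ⟨c, hc⟩, hqT⟩ := hq
    refine Or.inr (h.exists_hasPeriod_of_prime_dvd hq (B := Fintype.card G * c)
      (by rw [hcard, hc]; ring) ?_ hqT)
    intro hdvd
    rcases (Nat.Prime.dvd_mul hq).1 hdvd with h1 | h1
    · exact hq.one_lt.ne' (Nat.eq_one_of_dvd_coprimes hcop h1 (hc ▸ Dvd.intro _ rfl))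
    · have := hm q (by rw [hc]; exact Nat.mul_dvd_mul_left q h1)
      exact hq.one_lt.ne' (Nat.isUnit_iff.1 this)
  · have hmT : m.Coprime #T := by
      apply Nat.Coprime.symm
      rw [Nat.coprime_comm]
      exact Nat.coprime_of_dvd fun q hqp hqm hqT => hq ⟨q, hqp, hqm, hqT⟩
    have hG0 : Fintype.card G ≠ 0 := Fintype.card_ne_zero
    have hφ : (Fintype.card G).totient ≠ 0 := (Nat.totient_pos.2 (Nat.pos_of_ne_zero hG0)).ne'
    -- multiplication by a power of `m` maps `T` into `G × 0`
    obtain ⟨c, hc⟩ : m ∣ m ^ (Fintype.card G).totient := dvd_pow_self m hφ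
    have h1 : Tiles Ω
        ((T.image fun t => m ^ (Fintype.card G).totient • t.1).image
          fun t => (t, (0 : ZMod m))) := by
      convert h.image_nsmul (k := m ^ (Fintype.card G).totient) (pow_ne_zero _ (NeZero.ne m))
        (hmT.pow_left _) using 1
      rw [Finset.image_image]
      ext x
      simp only [Finset.mem_image, Function.comp_apply]
      refine exists_congr fun t => and_congr_right fun _ => ?_
      rw [show (m ^ (Fintype.card G).totient • t.1, (0 : ZMod m))
        = m ^ (Fintype.card G).totient • t from Prod.ext rfl (by simp [hc])]
    rw [tiles_prod_zero_iff] at h1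
    by_cases hGn : Nontrivial G
    · rcases hG hGn _ _ h1 with ⟨g, hg, hper⟩ | ⟨T', ⟨g, hg, hper⟩, hT'⟩
      · refine Or.inl ⟨(g, 0), by simpa using hg, fun f hf => ?_⟩
        have := hper f.2 f.1 (mem_slice.2 hf)
        convert mem_slice.1 this using 1
        exact Prod.ext rfl (by simp)
      · refine Or.inr ⟨_, ⟨(g, 0), by simpa using hg, fun f hf => ?_⟩, tiles_prod_zero_iff.2 hT'⟩
        obtain ⟨t, ht, rfl⟩ := Finset.mem_image.1 hf
        exact Finset.mem_image.2 ⟨t + g, hper t ht, by simp⟩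
    · -- if `G` is trivial, then `Ω` is the whole group
      left
      rw [not_nontrivial_iff_subsingleton] at hGn
      obtain ⟨g, hg⟩ := exists_ne (0 : G × ZMod m)
      refine ⟨g, hg, fun f hf => ?_⟩
      obtain ⟨w, hw, t, -, -⟩ := (h1 (f + g).2).exists_add_eq 0
      rw [mem_slice] at hw
      convert hw using 1
      exact Prod.ext (Subsingleton.elim _ _) rfl

end Slices

/-! ### The groups of the theorem -/

section Groups

/-- A nontrivial subgroup inherits a socle generator: either it contains the given one, or it is
annihilated by `p`. -/
lemma IsSocleGenerator.exists_of_injective {G H : Type*} [AddCommGroup G] [AddCommGroup H]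
    [Nontrivial G] {p : ℕ} {h : H} (hh : IsSocleGenerator p h) {f : G →+ H}
    (hf : Function.Injective f) : ∃ g : G, IsSocleGenerator p g := by
  by_cases hx : ∃ x : G, p • x ≠ 0
  · obtain ⟨x, hx⟩ := hx
    have hfx : ∀ x : G, p • x ≠ 0 → p • f x ≠ 0 := by
      intro x hx
      rw [← map_nsmul]
      exact (map_ne_zero_iff f hf).2 hx
    obtain ⟨j, hj⟩ := hh.eq_nsmul (f x) (hfx x hx)
    have hg : f (j • p • x) = h := by rw [hj, map_nsmul, map_nsmul]
    refine ⟨j • p • x, fun h0 => hh.ne_zero ?_, hf ?_, fun y hy => ?_⟩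
    · rw [← hg, h0, map_zero]
    · rw [map_nsmul, hg, hh.nsmul_eq_zero, map_zero]
    · obtain ⟨i, hi⟩ := hh.eq_nsmul (f y) (hfx y hy)
      exact ⟨i, hf (by rw [hg, hi, map_nsmul, map_nsmul])⟩
  · push Not at hx
    obtain ⟨g, hg⟩ := exists_ne (0 : G)
    exact ⟨g, hg, hx g, fun x h => absurd (hx x) h⟩

lemma exists_nsmul_eq_pow_zmod {p n : ℕ} (hp : p.Prime) {a : ZMod (p ^ (n + 1))} (ha : a ≠ 0) :
    ∃ j : ℕ, ((p ^ n : ℕ) : ZMod (p ^ (n + 1))) = j • a := by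
  have := NeZero.mk (pow_ne_zero (n + 1) hp.ne_zero)
  have hval : a.val ≠ 0 := by rwa [Ne, ZMod.val_eq_zero]
  obtain ⟨i, u, hu, hiu⟩ := Nat.exists_eq_pow_mul_and_not_dvd hval p hp.ne_one
  have hi : i ≤ n := by
    by_contra hlt
    apply ha
    rw [← ZMod.natCast_zmod_val a, ZMod.natCast_eq_zero_iff, hiu]
    exact Dvd.dvd.mul_right (pow_dvd_pow p (by omega)) u
  have hcop : u.Coprime p := ((Nat.Prime.coprime_iff_not_dvd hp).2 hu).symm
  obtain ⟨v, -, hv⟩ := Nat.exists_mul_mod_eq_one_of_coprime hcop hp.one_lt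
  refine ⟨p ^ (n - i) * v, ?_⟩
  rw [nsmul_eq_mul]
  conv_rhs => rw [← ZMod.natCast_zmod_val a, hiu]
  rw [← Nat.cast_mul]
  have h1 : p ^ (n - i) * v * (p ^ i * u) = p ^ n * (u * v) := by
    rw [show p ^ n = p ^ (n - i) * p ^ i by rw [← pow_add]; congr 1; omega]
    ring
  rw [h1, ← Nat.div_add_mod (u * v) p, hv, mul_add, mul_one, ← mul_assoc, ← pow_succ, Nat.cast_add,
    Nat.cast_mul (p ^ (n + 1)), ZMod.natCast_self]
  simp

lemma isSocleGenerator_prod {p n : ℕ} (hp : p.Prime) {E : Type*} [AddCommGroup E]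
    (hE : ∀ x : E, p • x = 0) :
    IsSocleGenerator p (((p ^ n : ℕ) : ZMod (p ^ (n + 1))), (0 : E)) where
  ne_zero h0 := by
    have := congrArg Prod.fst h0
    simp only [Prod.fst_zero] at this
    rw [ZMod.natCast_eq_zero_iff] at this
    have h1 := Nat.le_of_dvd (pow_pos hp.pos n) this
    exact absurd h1 (not_le.2 (Nat.pow_lt_pow_right hp.one_lt (Nat.lt_succ_self n)))
  nsmul_eq_zero := by
    ext
    · simp only [Prod.smul_fst, Prod.fst_zero, nsmul_eq_mul]
      rw [← Nat.cast_mul, ← pow_succ', ZMod.natCast_self]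
    · simp
  eq_nsmul x hx := by
    have hx1 : p • x.1 ≠ 0 := by
      intro h0
      exact hx (Prod.ext h0 (hE x.2))
    obtain ⟨j, hj⟩ := exists_nsmul_eq_pow_zmod hp hx1
    exact ⟨j, Prod.ext hj (by simp [hE])⟩

/-- Stated for an arbitrary decidability instance, to fit both the classical and the computable
one. -/
lemma card_torsion_zmod_prod_le {p n : ℕ} [NeZero p] [NeZero (p ^ n)]
    [DecidablePred fun x : ZMod (p ^ n) × ZMod p => p • x = 0] :
    #{x : ZMod (p ^ n) × ZMod p | p • x = 0} ≤ p ^ 2 := by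
  have h1 : ({x : ZMod (p ^ n) × ZMod p | p • x = 0} : Finset _)
      ⊆ ({x : ZMod (p ^ n) | p • x = 0} : Finset _) ×ˢ (Finset.univ : Finset (ZMod p)) := by
    intro x hx
    simp only [Finset.mem_filter, Finset.mem_univ, true_and, Finset.mem_product, and_true] at hx ⊢
    exact congrArg Prod.fst hx
  refine (Finset.card_le_card h1).trans ?_
  rw [Finset.card_product, Finset.card_univ, ZMod.card, sq]
  exact Nat.mul_le_mul_right _
    (IsAddCyclic.card_nsmul_eq_zero_le (Nat.pos_of_ne_zero (NeZero.ne p)))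

/-- The periodicity property for families passes to subgroups of the groups in question. -/
lemma commonPT_of_injective {G H ι : Type*} [AddCommGroup G] [Fintype G] [AddCommGroup H]
    [Fintype H] [Nontrivial G] {p L : ℕ} (hp : p.Prime) (hH : Fintype.card H = p ^ L) {h : H}
    (hh : IsSocleGenerator p h)
    (hcase : L ≤ 3 ∨ #{x : H | p • x = 0} ≤ p ^ 2 ∨ (p = 2 ∧ L ≤ 5))
    {f : G →+ H} (hf : Function.Injective f) {Ω : ι → Finset G} {T : Finset G}
    (hT : ∀ i, Tiles (Ω i) T) : CommonPT Ω := by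
  obtain ⟨g, hg⟩ := hh.exists_of_injective hf
  have hdvd : Fintype.card G ∣ Fintype.card H := by
    simpa using AddSubgroup.card_dvd_of_injective f hf
  rw [hH] at hdvd
  obtain ⟨e, he, hGe⟩ := (Nat.dvd_prime_pow hp).1 hdvd
  obtain ⟨N, rfl⟩ : ∃ N, e = N + 1 := by
    refine Nat.exists_eq_succ_of_ne_zero ?_
    rintro rfl
    exact Fintype.one_lt_card.ne' (by simpa using hGe)
  refine commonPT_of_tiles hp hGe hg ?_ hT
  rcases hcase with h1 | h1 | h1
  · exact Or.inl (he.trans h1)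
  · refine Or.inr (Or.inl (le_trans ?_ h1))
    refine Finset.card_le_card_of_injOn f ?_ hf.injOn
    intro x hx
    simp only [Finset.coe_filter, Finset.mem_univ, true_and, Set.mem_ofPred_eq] at hx ⊢
    rw [← map_nsmul, hx, map_zero]
  · exact Or.inr (Or.inr ⟨h1.1, he.trans h1.2⟩)

end Groups

end PeriodicTiling

open PeriodicTiling in
theorem theorem1p3 {G : Type*} [AddCommGroup G] (p n m : ℕ) (hp : p.Prime) (hn : 1 ≤ n)
    (hG : IsIsoToSubgroupOf G (Fin 5 → ZMod 2) ∨
      IsIsoToSubgroupOf G (Fin 3 → ZMod p) ∨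
      IsIsoToSubgroupOf G (ZMod (p ^ n) × ZMod p) ∨
      IsIsoToSubgroupOf G (ZMod (2 ^ 3) × (Fin 2 → ZMod 2)) ∨
      IsIsoToSubgroupOf G (ZMod (2 ^ 2) × (Fin 3 → ZMod 2)))
    (hm : Squarefree m) (hcop : Nat.Coprime (Nat.card G) m)
    (hnt : Nontrivial (G × ZMod m)) :
    HasPTProperty (G × ZMod m) := by
  have := NeZero.mk hp.ne_zero
  have := NeZero.mk (pow_ne_zero n hp.ne_zero)
  have := NeZero.mk hm.ne_zero
  have := Fact.mk hp
  have hzmod : ∀ (q k : ℕ) (x : Fin k → ZMod q), q • x = 0 := fun q k x => by ext; simp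
  have hone : ∀ (q k : ℕ) [Fact q.Prime] [NeZero k],
      IsSocleGenerator q (fun _ : Fin k => (1 : ZMod q)) := fun q k _ _ =>
    ⟨fun h => one_ne_zero (congrFun h 0), hzmod q k _, fun x h => absurd (hzmod q k x) h⟩
  have hfin : ∀ (H : Type) [AddCommGroup H] [Finite H], IsIsoToSubgroupOf G H →
      ∃ f : G →+ H, Function.Injective f := by
    rintro H _ _ ⟨K, ⟨e⟩⟩
    exact ⟨K.subtype.comp e.toAddMonoidHom, K.subtype_injective.comp e.injective⟩
  have hGfin : Finite G := by
    rcases hG with h | h | h | h | h <;> obtain ⟨f, hf⟩ := hfin _ h <;>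
      exact Finite.of_injective f hf
  have := Fintype.ofFinite G
  refine hasPTProperty_prod hm (by rwa [← Nat.card_eq_fintype_card]) hnt fun _ Ω T hT => ?_
  rcases hG with h | h | h | h | h <;> obtain ⟨f, hf⟩ := hfin _ h
  · exact commonPT_of_injective Nat.prime_two (L := 5) (by simp) (hone 2 5)
      (Or.inr (Or.inr ⟨rfl, le_rfl⟩)) hf hT
  · exact commonPT_of_injective hp (L := 3) (by simp) (hone p 3) (Or.inl le_rfl) hf hT
  · obtain ⟨k, rfl⟩ : ∃ k, n = k + 1 := ⟨n - 1, by omega⟩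
    exact commonPT_of_injective hp (L := k + 2) (by simp [pow_succ])
      (isSocleGenerator_prod hp fun x => by simp)
      (Or.inr (Or.inl (by convert card_torsion_zmod_prod_le (p := p) (n := k + 1)))) hf hT
  · exact commonPT_of_injective Nat.prime_two (L := 5) (by simp)
      (isSocleGenerator_prod (n := 2) Nat.prime_two fun x => hzmod 2 2 x)
      (Or.inr (Or.inr ⟨rfl, le_rfl⟩)) hf hT
  · exact commonPT_of_injective Nat.prime_two (L := 5) (by simp)
      (isSocleGenerator_prod (n := 1) Nat.prime_two fun x => hzmod 2 3 x)
      (Or.inr (Or.inr ⟨rfl, le_rfl⟩)) hf hT
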